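/- **Setting.** For $k\le p$ let $\beta$ be uniform on the vectors in $\{-1,0,1\}^p$ with exactly $k$ non-zero entries, let $X\in\mathbb R^{n\times p}$ have i.i.d. $N(0,1)$ entries, and let $w,w^{(1)},w^{(2)}\in\mathbb R^n$ have i.i.d. $N(0,1)$ entries, all independent. Absolute values and squares of vectors are taken entrywise. * *Sparse phase retrieval (SPR).* One observes $(X,y)$ with $y=g(X\beta)+\sigma w$, where $\sigma\ge 0$ and $g(x)=|x|$ or $g(x)=x^2$ is applied entrywise. The signal-to-noise ratio is $\mathrm{SNR}=\|\beta\|_2^2/\sigma^2=k/\sigma^2$ ($=\infty$ if $\sigma=0$). An algorithm solves exact (signed) support recovery along a sequence of parameters if its output $\hat\beta$ satisfies $\mathbb P[\hat\beta\in\{\beta,-\beta\}]\to1$; the global sign of $\beta$ is not identifiable. * *SBMSLRD (detection in the symmetric balanced mixture of sparse linear regressions).* Test the null $y=\sqrt{k+\sigma^2}\,w$, independent of $X$, against the planted law $y=X\beta_1\odot z+X\beta_2\odot(1-z)+\sigma w$ with $\beta_1=\beta$, $\beta_2=-\beta$ and $z_i$ i.i.d. $\mathrm{Bernoulli}(1/2)$.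 The noiseless problem is $\sigma=0$. * *SPRD (detection variant of SPR), $\sigma>0$.* Test the null $y=\sqrt{k/\sigma^2}\,|w^{(1)}|+w^{(2)}$, independent of $X$, against the planted law $y=\frac1\sigma|X\beta|+w$. A test solves *strong detection* if the sum of its Type I and Type II errors tends to $0$. **Parameter regimes.** For sequences $\theta=(p_i,n_i,k_i,\sigma_i)_{i}$ with $p_i,n_i,k_i\in\mathbb N$ and $\sigma_i\in[0,\infty)$, consider the base conditions $p_i\to\infty$, $k_i=o(\sqrt{p_i})$, $n_i=\omega(\max\{k_i,\log p_i\})$. Then $\theta\in\mathcal C_1$, $\mathcal C_2$, $\mathcal C_3$ if the base conditions hold and, respectively, $n_i=o\big((k_i+\sigma_i^2)^2/\log p_i\big)$; $n_i\gtrsim k_i\log p_i/\log(1+k_i/\sigma_i^2)$ (no condition where $\sigma_i=0$); $n_i=o\big(k_i^2/\log p_i\big)$. Here $\mathcal C_1$ is the regime $n=o\big(\frac{k^2(\mathrm{SNR}+1)^2}{\mathrm{SNR}^2\log p}\big)$ in which SBMSLRD is conjecturally hard. Write $\theta^0=(p_i,n_i,k_i,0)_i$. **Algorithms.** A randomized algorithm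 is a program for a real RAM (exact real arithmetic, comparisons, integer index variables, and draws of independent $N(0,1)$ variables, each step at unit cost). Its input is $(p,n,k)$, one real parameter $\tau$, and $(X,y)$. It runs in polynomial time along $\theta$ if for some constant $c$ it halts within $c(p_i^c+1)$ steps for every $i$, every input $(X,y)$ and every outcome of the random draws. Algorithms for SPR and SPRD along $\theta$ are given $\tau=\sigma_i$. **Theorem.** 1. Let $g(x)=|x|$ or $g(x)=x^2$. For every randomized algorithm $A$ there is a randomized algorithm $B$ such that for every $\theta\in\mathcal C_2\cap\mathcal C_3$ with $\mathrm{SNR}_i\to\infty$: if $A$ runs in polynomial time along $\theta$ and solves exact support recovery for SPR along $\theta$, then $\theta^0\in\mathcal C_1\cap\mathcal C_2\cap\mathcal C_3$, and $B$, given $\tau=\sigma_i$, runs in polynomial time and solves strong detection in noiseless SBMSLRD along $\theta^0$. 2. Consequently, for every such $g$ and $\theta$, a randomized polynomial-time algorithm for exact support recovery in SPR along $\theta$ contradicts the hardness of SBMSLRD in the regime $\mathcal C_1$: if (as $\theta^0\in\mathcal C_1$) no randomized polynomial-time algorithm, with any choice of the parameters $\tau_i$, solves strong detection in noiseless SBMSLRD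 along $\theta^0$, then no randomized polynomial-time algorithm solves exact support recovery in SPR along $\theta$. 3. For every randomized algorithm $A$ there is a randomized algorithm $B$ such that for every $\theta\in\mathcal C_3$ with all $\sigma_i>0$: if $A$ runs in polynomial time and solves strong detection in SPRD along $\theta$, then $\theta^0\in\mathcal C_3$, and $B$, given $\tau=\sigma_i$, runs in polynomial time and solves strong detection in noiseless SBMSLRD along $\theta^0$. -/

import Mathlib

open MeasureTheory ProbabilityTheory Filter Asymptotics
open scoped Topology ENNReal

noncomputable section

/-! ### Randomized algorithms on real data: a real RAM with a step count

Memory consists of natural-number variables and of real two-dimensional arrays, addressed by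
natural-number variables.  The machine does exact real arithmetic, compares reals, and can draw
independent standard Gaussians. -/

/-- The real memory cell in array number `arr`, at the row and the column that are the current
values of the natural-number variables `row` and `col`. -/
structure Ref where
  arr : ℕ
  row : ℕ
  col : ℕ

/-- Programs. -/
inductive Prog where
  /-- `u := c` -/
  | natConst (u c : ℕ)
  /-- `u := v + w` -/
  | natAdd (u v w : ℕ)
  /-- `u := max (v - w) 0` -/
  | natSub (u v w : ℕ)
  /-- `x := c` -/
  | const (x : Ref) (c : ℚ)
  /-- `x := u`, the value of a natural-number variable -/
  | cast (x : Ref) (u : ℕ)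
  /-- `x := y + z` -/
  | add (x y z : Ref)
  /-- `x := y - z` -/
  | sub (x y z : Ref)
  /-- `x := y * z` -/
  | mul (x y z : Ref)
  /-- `x := y / z`, with value `0` if `z = 0` -/
  | div (x y z : Ref)
  /-- `x :=` a fresh standard Gaussian -/
  | sample (x : Ref)
  /-- first `P`, then `Q` -/
  | seq (P Q : Prog)
  /-- if `u < v` (natural-number variables) then `P`, else `Q` -/
  | ifNat (u v : ℕ) (P Q : Prog)
  /-- if `x < y` (real cells) then `P`, else `Q` -/
  | ifReal (x y : Ref) (P Q : Prog)
  /-- while `u < v` (natural-number variables) do `P` -/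
  | while (u v : ℕ) (P : Prog)

/-- Memory contents, and the random numbers that have not been used yet. -/
structure MemState where
  nat : ℕ → ℕ
  arr : ℕ → ℕ → ℕ → ℝ
  tape : ℕ → ℝ

namespace MemState

/-- The value of a real cell. -/
def read (s : MemState) (x : Ref) : ℝ := s.arr x.arr (s.nat x.row) (s.nat x.col)

/-- Overwrite a natural-number variable. -/
def setNat (s : MemState) (u c : ℕ) : MemState :=
  { s with nat := Function.update s.nat u c }

/-- Overwrite a real cell. -/
def write (s : MemState) (x : Ref) (v : ℝ) : MemState :=
  { s with
    arr := fun a i j =>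
      if a = x.arr ∧ i = s.nat x.row ∧ j = s.nat x.col then v else s.arr a i j }

end MemState

/-- One step of the machine.  A configuration is the list of programs that remain to be executed,
together with the memory; the machine has halted when the list is empty. -/
def machineStep : List Prog × MemState → List Prog × MemState
  | ([], s) => ([], s)
  | (.natConst u c :: K, s) => (K, s.setNat u c)
  | (.natAdd u v w :: K, s) => (K, s.setNat u (s.nat v + s.nat w))
  | (.natSub u v w :: K, s) => (K, s.setNat u (s.nat v - s.nat w))
  | (.const x c :: K, s) => (K, s.write x (c : ℝ))
  | (.cast x u :: K, s) => (K, s.write x (s.nat u : ℝ))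
  | (.add x y z :: K, s) => (K, s.write x (s.read y + s.read z))
  | (.sub x y z :: K, s) => (K, s.write x (s.read y - s.read z))
  | (.mul x y z :: K, s) => (K, s.write x (s.read y * s.read z))
  | (.div x y z :: K, s) => (K, s.write x (s.read y / s.read z))
  | (.sample x :: K, s) => (K, { s.write x (s.tape 0) with tape := fun m => s.tape (m + 1) })
  | (.seq P Q :: K, s) => (P :: Q :: K, s)
  | (.ifNat u v P Q :: K, s) => if s.nat u < s.nat v then (P :: K, s) else (Q :: K, s)
  | (.ifReal x y P Q :: K, s) =>
      haveI := Classical.propDecidable (s.read x < s.read y)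
      if s.read x < s.read y then (P :: K, s) else (Q :: K, s)
  | (.while u v P :: K, s) =>
      if s.nat u < s.nat v then (P :: .while u v P :: K, s) else (K, s)

/-- `P`, started in `s`, halts after at most `T` steps. -/
def HaltsWithin (P : Prog) (s : MemState) (T : ℕ) : Prop :=
  (machineStep^[T] ([P], s)).1 = []

/-- `P`, started in `s`, halts in the final state `s'`. -/
def HaltsIn (P : Prog) (s s' : MemState) : Prop :=
  ∃ T : ℕ, machineStep^[T] ([P], s) = ([], s')

/-! ### Data, input and output conventions -/

/-- An `n × p` design matrix. -/
abbrev Design (n p : ℕ) := Fin n → Fin p → ℝ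

/-- A data set `(X, y)`. -/
abbrev Data (n p : ℕ) := Design n p × (Fin n → ℝ)

/-- Input: variables `0, 1, 2` hold `p, n, k`; array `0` holds the matrix `X`; array `1` holds `y`
as its column `0`; cell `(0, 0)` of array `2` holds the real parameter `τ`; all other variables and
cells are zero.  The random numbers are the entries of `t`. -/
def inputState (p n k : ℕ) (τ : ℝ) (d : Data n p) (t : ℕ → ℝ) : MemState where
  nat u := if u = 0 then p else if u = 1 then n else if u = 2 then k else 0
  arr a r j :=
    if a = 0 then (if h : r < n ∧ j < p then d.1 ⟨r, h.1⟩ ⟨j, h.2⟩ else 0)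
    else if a = 1 then (if h : r < n ∧ j = 0 then d.2 ⟨r, h.1⟩ else 0)
    else if a = 2 ∧ r = 0 ∧ j = 0 then τ
    else 0
  tape := t

/-- Output of an estimator: column `0` of array `3`. -/
def outputVector (p : ℕ) (s : MemState) : Fin p → ℝ := fun j => s.arr 3 j 0

/-- Output of a test: variable `3`, with value `1` for "planted" and `0` for "null". -/
def outputBit (s : MemState) : ℕ := s.nat 3

/-! ### Distributions -/

/-- The law of an i.i.d. sequence of standard Gaussians, the random source of the machine. -/
def tapeLaw : Measure (ℕ → ℝ) := Measure.infinitePi fun _ : ℕ => gaussianReal 0 1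

/-- The law of a vector with i.i.d. standard Gaussian entries. -/
def gaussVec (n : ℕ) : Measure (Fin n → ℝ) := Measure.pi fun _ => gaussianReal 0 1

/-- The law of a design matrix with i.i.d. standard Gaussian entries. -/
def gaussMat (n p : ℕ) : Measure (Design n p) :=
  Measure.pi fun _ => Measure.pi fun _ => gaussianReal 0 1

/-- The law of i.i.d. fair coin flips. -/
def fairCoins (n : ℕ) : Measure (Fin n → Bool) := Measure.pi fun _ => uniformOn Set.univ

/-- Vectors in `{-1, 0, 1}^p` with exactly `k` non-zero entries. -/
def sparseSigns (p k : ℕ) : Set (Fin p → ℝ) :=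
  {β | (∀ j, β j = -1 ∨ β j = 0 ∨ β j = 1) ∧ {j | β j ≠ 0}.ncard = k}

/-- The signal prior: uniform on `sparseSigns p k`. -/
def signalPrior (p k : ℕ) : Measure (Fin p → ℝ) := uniformOn (sparseSigns p k)

/-- The `r`-th entry of `X β`. -/
def rowProd {n p : ℕ} (X : Design n p) (β : Fin p → ℝ) (r : Fin n) : ℝ := ∑ j, X r j * β j

/-- Mixed linear regression: `y = X β₁ ⊙ z + X β₂ ⊙ (1 - z) + σ w`. -/
def mslrObs {n p : ℕ} (σ : ℝ) (X : Design n p) (β₁ β₂ : Fin p → ℝ) (z : Fin n → Bool)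
    (w : Fin n → ℝ) : Fin n → ℝ :=
  fun r => (if z r then rowProd X β₁ r else rowProd X β₂ r) + σ * w r

/-- Planted law in the detection problem for the symmetric balanced mixture: `β₂ = -β₁`, fair
labels.  The observation is not divided by `σ`, so that `σ = 0` is the noiseless problem. -/
def sbmslrdPlanted (p n k : ℕ) (σ : ℝ) : Measure (Data n p) :=
  Measure.map (fun q => (q.2.1, mslrObs σ q.2.1 q.1 (-q.1) q.2.2.1 q.2.2.2))
    ((signalPrior p k).prod ((gaussMat n p).prod ((fairCoins n).prod (gaussVec n))))

/-- Null law in the detection problem for the symmetric balanced mixture: `X` and `y` are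
independent, with the same marginals as under the planted law (`‖β‖₂² = k`). -/
def sbmslrdNull (p n k : ℕ) (σ : ℝ) : Measure (Data n p) :=
  Measure.map (fun q => (q.1, fun r => √((k : ℝ) + σ ^ 2) * q.2 r))
    ((gaussMat n p).prod (gaussVec n))

/-- Sparse phase retrieval: `y = g(X β) + σ w`. -/
def sprObs {n p : ℕ} (g : ℝ → ℝ) (σ : ℝ) (X : Design n p) (β : Fin p → ℝ) (w : Fin n → ℝ) :
    Fin n → ℝ :=
  fun r => g (rowProd X β r) + σ * w r

/-- Planted law in the detection variant of sparse phase retrieval: `y = |X β| / σ + w`. -/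
def sprdPlanted (p n k : ℕ) (σ : ℝ) : Measure (Data n p) :=
  Measure.map (fun q => (q.2.1, fun r => 1 / σ * |rowProd q.2.1 q.1 r| + q.2.2 r))
    ((signalPrior p k).prod ((gaussMat n p).prod (gaussVec n)))

/-- Null law in the detection variant of sparse phase retrieval: `y = √(‖β‖₂² / σ²) |w₁| + w₂`,
independent of `X`. -/
def sprdNull (p n k : ℕ) (σ : ℝ) : Measure (Data n p) :=
  Measure.map (fun q => (q.1, fun r => √((k : ℝ) / σ ^ 2) * |q.2.1 r| + q.2.2 r))
    ((gaussMat n p).prod ((gaussVec n).prod (gaussVec n)))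

/-! ### Parameter sequences and regimes -/

/-- A sequence of parameters `(p_i, n_i, k_i, σ_i)`. -/
structure ParamSeq where
  p : ℕ → ℕ
  n : ℕ → ℕ
  k : ℕ → ℕ
  σ : ℕ → ℝ
  σ_nonneg : ∀ i, 0 ≤ σ i

namespace ParamSeq

/-- The same dimensions without noise. -/
def noiseless (θ : ParamSeq) : ParamSeq where
  p := θ.p
  n := θ.n
  k := θ.k
  σ := fun _ => 0
  σ_nonneg := fun _ => le_rfl

/-- The signal-to-noise ratio `‖β‖₂² / σ² = k / σ²`, infinite in the noiseless case. -/
def snr (θ : ParamSeq) (i : ℕ) : ℝ≥0∞ := (θ.k i : ℝ≥0∞) / ENNReal.ofReal (θ.σ i ^ 2)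

/-- `p = ω(1)`, `k = o(√p)`, `n = ω(max{k, log p})`. -/
def Base (θ : ParamSeq) : Prop :=
  Tendsto θ.p atTop atTop ∧
  (fun i => (θ.k i : ℝ)) =o[atTop] (fun i => √(θ.p i : ℝ)) ∧
  (fun i => max (θ.k i : ℝ) (Real.log (θ.p i))) =o[atTop] (fun i => (θ.n i : ℝ))

/-- The critical regime of the detection problem: moreover `n = o((k + σ²)² / log p)`, where
`(k + σ²)² = k² (snr + 1)² / snr²`. -/
def C1 (θ : ParamSeq) : Prop :=
  θ.Base ∧
  (fun i => (θ.n i : ℝ)) =o[atTop]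
    (fun i => ((θ.k i : ℝ) + θ.σ i ^ 2) ^ 2 / Real.log (θ.p i))

/-- Moreover `n ≳ k log p / log(1 + k / σ²)`; there is no constraint where `σ = 0`. -/
def C2 (θ : ParamSeq) : Prop :=
  θ.Base ∧
  ∃ C : ℝ, 0 < C ∧ ∀ᶠ i in atTop, θ.σ i ≠ 0 →
    C * ((θ.k i : ℝ) * Real.log (θ.p i) / Real.log (1 + (θ.k i : ℝ) / θ.σ i ^ 2)) ≤ (θ.n i : ℝ)

/-- Moreover `n = o(k² / log p)`. -/
def C3 (θ : ParamSeq) : Prop :=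
  θ.Base ∧
  (fun i => (θ.n i : ℝ)) =o[atTop] (fun i => (θ.k i : ℝ) ^ 2 / Real.log (θ.p i))

end ParamSeq

/-! ### Polynomial time, recovery, detection -/

/-- Along `θ`, and given the real parameter `τ i`, the program halts on all inputs and for all
random choices within `O(p^c)` steps, for some `c`. -/
def PolyTime (A : Prog) (τ : ℕ → ℝ) (θ : ParamSeq) : Prop :=
  ∃ c : ℕ, ∀ (i : ℕ) (d : Data (θ.n i) (θ.p i)) (t : ℕ → ℝ),
    HaltsWithin A (inputState (θ.p i) (θ.n i) (θ.k i) (τ i) d t) (c * (θ.p i ^ c + 1))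

/-- `A`, which is given `σ`, recovers the signal in sparse phase retrieval exactly, up to the
unidentifiable global sign, with probability tending to `1`. -/
def SolvesSPR (g : ℝ → ℝ) (A : Prog) (θ : ParamSeq) : Prop :=
  Tendsto
    (fun i =>
      ((signalPrior (θ.p i) (θ.k i)).prod
        ((gaussMat (θ.n i) (θ.p i)).prod ((gaussVec (θ.n i)).prod tapeLaw)))
        {q | ¬ ∃ s',
          HaltsIn A (inputState (θ.p i) (θ.n i) (θ.k i) (θ.σ i)
            (q.2.1, sprObs g (θ.σ i) q.2.1 q.1 q.2.2.1) q.2.2.2) s' ∧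
          (outputVector (θ.p i) s' = q.1 ∨ outputVector (θ.p i) s' = -q.1)})
    atTop (𝓝 0)

/-- `B`, which is given the real parameter `τ i`, strongly distinguishes the laws `H₀ i` (null) and
`H₁ i` (planted): the sum of the Type I and the Type II error tends to `0`. -/
def StronglyDetects (B : Prog) (τ : ℕ → ℝ) (θ : ParamSeq)
    (H₀ H₁ : ∀ i, Measure (Data (θ.n i) (θ.p i))) : Prop :=
  Tendsto
    (fun i =>
      ((H₀ i).prod tapeLaw) {q | ¬ ∃ s',
          HaltsIn B (inputState (θ.p i) (θ.n i) (θ.k i) (τ i) q.1 q.2) s' ∧ outputBit s' = 0} +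
      ((H₁ i).prod tapeLaw) {q | ¬ ∃ s',
          HaltsIn B (inputState (θ.p i) (θ.n i) (θ.k i) (τ i) q.1 q.2) s' ∧ outputBit s' = 1})
    atTop (𝓝 0)

/-- Strong detection in the symmetric balanced mixture with parameters `θ`. -/
def SolvesSBMSLRD (B : Prog) (τ : ℕ → ℝ) (θ : ParamSeq) : Prop :=
  StronglyDetects B τ θ (fun i => sbmslrdNull (θ.p i) (θ.n i) (θ.k i) (θ.σ i))
    (fun i => sbmslrdPlanted (θ.p i) (θ.n i) (θ.k i) (θ.σ i))

/-- Strong detection in sparse phase retrieval with parameters `θ`; the test is given `σ`. -/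
def SolvesSPRD (B : Prog) (θ : ParamSeq) : Prop :=
  StronglyDetects B θ.σ θ (fun i => sprdNull (θ.p i) (θ.n i) (θ.k i) (θ.σ i))
    (fun i => sprdPlanted (θ.p i) (θ.n i) (θ.k i) (θ.σ i))

/-- The hardness assertion, at the parameter sequence `θ`, of the lower bound for detection in the
symmetric balanced mixture: no randomized polynomial-time algorithm, whatever real parameter it is
given, solves strong detection. -/
def SBMSLRDHard (θ : ParamSeq) : Prop :=
  ∀ (B : Prog) (τ : ℕ → ℝ), ¬ (PolyTime B τ θ ∧ SolvesSBMSLRD B τ θ)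

end

/-! In the noiseless mixture the hidden labels only flip signs: each observation is `±rowProd X β r`
(`abs_mslrObs`). For even `g`, applying `g` therefore erases the labels, and adding `σ w`, with `w`
drawn from the machine's own tape, produces an exact instance of sparse phase retrieval on which a
recovery algorithm `A` can be run. Its output is rounded to signs, and the squared prediction of the
first original observation is compared with the square of that observation.

Under the planted law the test accepts whenever `A` returns `±β` (`testProg_planted_failure`). Under
the null law the first observation is a nondegenerate Gaussian independent of `X`, and rounding
leaves at most `3 ^ p` candidates. An exact match thus has probability zero, however `A` behaves
(`sbmslrdNull_prediction_eq_zero`, `testProg_null_failure`).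

For the detection variant no verification is needed: `|y| / σ + w` carries the null law to the null
law and the planted law to the planted law (`map_modifyData_null`, `map_modifyData_planted`), so the
output bit of `A` can be used as it is.

To realise this by programs, note that `A` mentions finitely many variables and arrays. Those from
some `M` on are private to the reduction, and `A` neither sees nor alters them (`Reaches.overlay`).
The overhead is linear in `p + n`, and `C3` gives `n ≤ k ^ 2 ≤ p` eventually, so polynomial time is
preserved (`PolyTime.of_reduction`). The success and failure events of a program are never shown to
be measurable; all comparisons are between outer measures. -/

noncomputable section

/-! ### Execution of programs -/

/-- Started in `s`, the program `P` is completed in the state `s'`, within `T` steps. -/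
def Reaches (P : Prog) (s s' : MemState) (T : ℕ) : Prop :=
  ∃ m ≤ T, ∀ K, machineStep^[m] (P :: K, s) = (K, s')

theorem machineStep_iterate_nil (m : ℕ) (s : MemState) :
    machineStep^[m] ([], s) = ([], s) :=
  Function.iterate_fixed rfl m

theorem Reaches.haltsIn {P : Prog} {s s' : MemState} {T : ℕ} (h : Reaches P s s' T) :
    HaltsIn P s s' := by
  obtain ⟨m, -, h⟩ := h
  exact ⟨m, h []⟩

theorem Reaches.haltsWithin {P : Prog} {s s' : MemState} {T T' : ℕ} (h : Reaches P s s' T)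
    (hT : T ≤ T') : HaltsWithin P s T' := by
  obtain ⟨m, hm, h⟩ := h
  obtain ⟨d, rfl⟩ := Nat.exists_eq_add_of_le (hm.trans hT)
  rw [HaltsWithin, Nat.add_comm, Function.iterate_add_apply, h, machineStep_iterate_nil]

theorem Reaches.mono {P : Prog} {s s' : MemState} {T T' : ℕ} (h : Reaches P s s' T)
    (hT : T ≤ T') : Reaches P s s' T' :=
  let ⟨m, hm, h⟩ := h
  ⟨m, hm.trans hT, h⟩

theorem machineStep_append {L : List Prog} (hL : L ≠ []) (K : List Prog) (s : MemState) :
    machineStep (L ++ K, s) = ((machineStep (L, s)).1 ++ K, (machineStep (L, s)).2) := by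
  cases L with
  | nil => exact absurd rfl hL
  | cons P L =>
    cases P <;> simp only [List.cons_append, machineStep] <;> split_ifs <;> rfl

/-- A halted machine idles, but with a continuation `K` it would go on running. Hence the time `m ≤
T` at which `L` is used up replaces `T`; it does not depend on `K`, because a step inspects only the
head of the list. -/
theorem exists_iterate_append (T : ℕ) (L : List Prog) (s s' : MemState)
    (h : machineStep^[T] (L, s) = ([], s')) :
    ∃ m ≤ T, ∀ K, machineStep^[m] (L ++ K, s) = (K, s') := by
  induction T generalizing L s with
  | zero =>
    obtain ⟨rfl, rfl⟩ := Prod.mk.inj h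
    exact ⟨0, le_rfl, fun K => rfl⟩
  | succ T ih =>
    by_cases hL : L = []
    · subst hL
      rw [machineStep_iterate_nil] at h
      obtain ⟨-, rfl⟩ := Prod.mk.inj h
      exact ⟨0, Nat.zero_le _, fun K => rfl⟩
    · rw [Function.iterate_succ_apply] at h
      obtain ⟨m, hm, h'⟩ := ih (machineStep (L, s)).1 (machineStep (L, s)).2 h
      refine ⟨m + 1, by omega, fun K => ?_⟩
      rw [Function.iterate_succ_apply, machineStep_append hL, h']

theorem HaltsWithin.exists_reaches {P : Prog} {s : MemState} {T : ℕ} (h : HaltsWithin P s T) :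
    ∃ s', Reaches P s s' T := by
  obtain ⟨m, hm, h'⟩ := exists_iterate_append T [P] s (machineStep^[T] ([P], s)).2
    (Prod.ext h rfl)
  exact ⟨_, m, hm, h'⟩

theorem HaltsIn.eq_of_reaches {P : Prog} {s s' s'' : MemState} {T : ℕ} (h : HaltsIn P s s')
    (h' : Reaches P s s'' T) : s' = s'' := by
  obtain ⟨m, hm⟩ := h
  obtain ⟨m', -, hm'⟩ := h'
  have h1 : machineStep^[m' + m] ([P], s) = ([], s') := by
    rw [Function.iterate_add_apply, hm, machineStep_iterate_nil]
  have h2 : machineStep^[m + m'] ([P], s) = ([], s'') := by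
    rw [Function.iterate_add_apply, hm', machineStep_iterate_nil]
  rw [Nat.add_comm, h1] at h2
  exact (Prod.mk.inj h2).2

theorem Reaches.of_step {P : Prog} {s s' : MemState}
    (h : ∀ K, machineStep (P :: K, s) = (K, s')) : Reaches P s s' 1 :=
  ⟨1, le_rfl, h⟩

theorem Reaches.seq {P Q : Prog} {s s₁ s₂ : MemState} {a b : ℕ} (hP : Reaches P s s₁ a)
    (hQ : Reaches Q s₁ s₂ b) : Reaches (.seq P Q) s s₂ (a + b + 1) := by
  obtain ⟨m, hm, hP⟩ := hP
  obtain ⟨l, hl, hQ⟩ := hQ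
  refine ⟨l + (m + 1), by omega, fun K => ?_⟩
  rw [Function.iterate_add_apply, Function.iterate_succ_apply, machineStep, hP, hQ]

theorem Reaches.ifReal {x y : Ref} {P Q : Prog} {s s' : MemState} {a : ℕ}
    (hP : s.read x < s.read y → Reaches P s s' a)
    (hQ : ¬ s.read x < s.read y → Reaches Q s s' a) : Reaches (.ifReal x y P Q) s s' (a + 1) := by
  by_cases h : s.read x < s.read y
  · obtain ⟨m, hm, hP⟩ := hP h
    refine ⟨m + 1, by omega, fun K => ?_⟩
    rw [Function.iterate_succ_apply, machineStep, if_pos h, hP]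
  · obtain ⟨m, hm, hQ⟩ := hQ h
    refine ⟨m + 1, by omega, fun K => ?_⟩
    rw [Function.iterate_succ_apply, machineStep, if_neg h, hQ]

/-- A loop that counts up to `N`, with a loop invariant. -/
theorem Reaches.loop {u v : ℕ} {P : Prog} (I : ℕ → MemState → Prop) {N b : ℕ}
    (hvar : ∀ i s, I i s → s.nat u = i ∧ s.nat v = N)
    (hstep : ∀ i < N, ∀ s, I i s → ∃ s', Reaches P s s' b ∧ I (i + 1) s')
    {s : MemState} (hs : I 0 s) :
    ∃ s', Reaches (.while u v P) s s' (N * (b + 1) + 1) ∧ I N s' := by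
  -- Induction on the number `m` of remaining passes. Each pass costs `b` steps and one guard test;
  -- the final `1` is the failing test.
  suffices H : ∀ m i s, i + m = N → I i s →
      ∃ s', Reaches (.while u v P) s s' (m * (b + 1) + 1) ∧ I N s' from
    H N 0 s (Nat.zero_add N) hs
  intro m
  induction m with
  | zero =>
    intro i s hi hI
    obtain rfl : i = N := by omega
    obtain ⟨h1, h2⟩ := hvar i s hI
    refine ⟨s, (Reaches.of_step fun K => ?_).mono (by omega), hI⟩
    rw [machineStep, if_neg (by omega)]
  | succ m ih =>
    intro i s hi hI
    obtain ⟨h1, h2⟩ := hvar i s hI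
    obtain ⟨s₁, ⟨l, hl, hP⟩, hI₁⟩ := hstep i (by omega) s hI
    obtain ⟨s₂, ⟨l', hl', hW⟩, hI₂⟩ := ih (i + 1) s₁ (by omega) hI₁
    refine ⟨s₂, ⟨l' + (l + 1), by rw [Nat.add_mul]; omega, fun K => ?_⟩, hI₂⟩
    rw [Function.iterate_add_apply, Function.iterate_succ_apply, machineStep,
      if_pos (by omega), hP, hW]

/-! ### Programs do not touch the variables and arrays they do not mention -/

/-- All the variables and arrays of a reference have numbers below `M`. -/
def Ref.Below (M : ℕ) (x : Ref) : Prop := x.arr < M ∧ x.row < M ∧ x.col < M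

/-- All the variables and arrays of a program have numbers below `M`. -/
def Prog.Below (M : ℕ) : Prog → Prop
  | .natConst u _ => u < M
  | .natAdd u v w => u < M ∧ v < M ∧ w < M
  | .natSub u v w => u < M ∧ v < M ∧ w < M
  | .const x _ => x.Below M
  | .cast x u => x.Below M ∧ u < M
  | .add x y z => x.Below M ∧ y.Below M ∧ z.Below M
  | .sub x y z => x.Below M ∧ y.Below M ∧ z.Below M
  | .mul x y z => x.Below M ∧ y.Below M ∧ z.Below M
  | .div x y z => x.Below M ∧ y.Below M ∧ z.Below M
  | .sample x => x.Below M
  | .seq P Q => P.Below M ∧ Q.Below M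
  | .ifNat u v P Q => u < M ∧ v < M ∧ P.Below M ∧ Q.Below M
  | .ifReal x y P Q => x.Below M ∧ y.Below M ∧ P.Below M ∧ Q.Below M
  | .while u v P => u < M ∧ v < M ∧ P.Below M

theorem Ref.eventually_below (x : Ref) : ∀ᶠ M in atTop, x.Below M :=
  (eventually_gt_atTop _).and ((eventually_gt_atTop _).and (eventually_gt_atTop _))

/-- A program is a finite term. Stating this along `atTop` lets the bounds for subprograms, and
later `4 ≤ M`, be combined by intersection. -/
theorem Prog.eventually_below (P : Prog) : ∀ᶠ M in atTop, P.Below M := by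
  induction P with
  | natConst u c => exact eventually_gt_atTop u
  | natAdd u v w =>
    exact (eventually_gt_atTop _).and ((eventually_gt_atTop _).and (eventually_gt_atTop _))
  | natSub u v w =>
    exact (eventually_gt_atTop _).and ((eventually_gt_atTop _).and (eventually_gt_atTop _))
  | const x c => exact x.eventually_below
  | cast x u => exact x.eventually_below.and (eventually_gt_atTop _)
  | add x y z => exact x.eventually_below.and (y.eventually_below.and z.eventually_below)
  | sub x y z => exact x.eventually_below.and (y.eventually_below.and z.eventually_below)
  | mul x y z => exact x.eventually_below.and (y.eventually_below.and z.eventually_below)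
  | div x y z => exact x.eventually_below.and (y.eventually_below.and z.eventually_below)
  | sample x => exact x.eventually_below
  | seq P Q hP hQ => exact hP.and hQ
  | ifNat u v P Q hP hQ =>
    exact (eventually_gt_atTop _).and ((eventually_gt_atTop _).and (hP.and hQ))
  | ifReal x y P Q hP hQ => exact x.eventually_below.and (y.eventually_below.and (hP.and hQ))
  | _ u v P hP => exact (eventually_gt_atTop _).and ((eventually_gt_atTop _).and hP)

namespace MemState

/-- The memory of `s` below `M`, and that of `e` from `M` on. -/
def overlay (M : ℕ) (s e : MemState) : MemState where
  nat u := if u < M then s.nat u else e.nat u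
  arr a := if a < M then s.arr a else e.arr a
  tape := s.tape

theorem overlay_read {M : ℕ} (s e : MemState) {x : Ref} (hx : x.Below M) :
    (overlay M s e).read x = s.read x := by
  obtain ⟨h1, h2, h3⟩ := hx
  simp [overlay, read, h1, h2, h3]

theorem overlay_nat {M : ℕ} (s e : MemState) {u : ℕ} (hu : u < M) :
    (overlay M s e).nat u = s.nat u := if_pos hu

theorem overlay_setNat {M : ℕ} (s e : MemState) {u : ℕ} (hu : u < M) (c : ℕ) :
    (overlay M s e).setNat u c = overlay M (s.setNat u c) e := by
  simp only [overlay, setNat, mk.injEq, and_true]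
  funext v
  by_cases hv : v = u
  · simp [hv, hu]
  · simp [Function.update_of_ne hv]

theorem overlay_write {M : ℕ} (s e : MemState) {x : Ref} (hx : x.Below M) (c : ℝ) :
    (overlay M s e).write x c = overlay M (s.write x c) e := by
  obtain ⟨h1, h2, h3⟩ := hx
  simp only [overlay, write, mk.injEq, and_true, true_and, if_pos h2, if_pos h3]
  funext a i j
  by_cases ha : a < M
  · simp [ha]
  · have : a ≠ x.arr := by omega
    simp [ha, this]

theorem overlay_eq_self {M : ℕ} {s e : MemState} (hn : ∀ u < M, e.nat u = s.nat u)
    (ha : ∀ a < M, e.arr a = s.arr a) (ht : e.tape = s.tape) : overlay M s e = e := by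
  cases e
  simp only [overlay, mk.injEq]
  refine ⟨funext fun u => ?_, funext fun a => ?_, ht.symm⟩
  · split_ifs with h
    · exact (hn u h).symm
    · rfl
  · split_ifs with h
    · exact (ha a h).symm
    · rfl

end MemState

/-- Frame property. Array numbers in a `Ref` are fixed in the program text, and only row and column
are computed at run time, so no indirect addressing can reach an array from `M` on. -/
theorem machineStep_overlay {M : ℕ} (e : MemState) {L : List Prog} (hL : ∀ P ∈ L, P.Below M)
    (s : MemState) :
    machineStep (L, s.overlay M e) =
        ((machineStep (L, s)).1, (machineStep (L, s)).2.overlay M e) ∧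
      ∀ P ∈ (machineStep (L, s)).1, P.Below M := by
  cases L with
  | nil => exact ⟨rfl, hL⟩
  | cons P L =>
    obtain ⟨hP, hL'⟩ := List.forall_mem_cons.1 hL
    cases P <;> simp only [Prog.Below] at hP
    case natConst => exact ⟨by simp [machineStep, MemState.overlay_setNat, *], hL'⟩
    case natAdd =>
      exact ⟨by simp [machineStep, MemState.overlay_setNat, MemState.overlay_nat, *], hL'⟩
    case natSub =>
      exact ⟨by simp [machineStep, MemState.overlay_setNat, MemState.overlay_nat, *], hL'⟩
    case const => exact ⟨by simp [machineStep, MemState.overlay_write, *], hL'⟩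
    case cast =>
      exact ⟨by simp [machineStep, MemState.overlay_write, MemState.overlay_nat, *], hL'⟩
    case add =>
      exact ⟨by simp [machineStep, MemState.overlay_write, MemState.overlay_read, *], hL'⟩
    case sub =>
      exact ⟨by simp [machineStep, MemState.overlay_write, MemState.overlay_read, *], hL'⟩
    case mul =>
      exact ⟨by simp [machineStep, MemState.overlay_write, MemState.overlay_read, *], hL'⟩
    case div =>
      exact ⟨by simp [machineStep, MemState.overlay_write, MemState.overlay_read, *], hL'⟩
    case sample =>
      refine ⟨?_, hL'⟩
      simp only [machineStep, MemState.overlay_write _ _ hP]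
      rfl
    case seq => exact ⟨rfl, by simpa [machineStep, hP] using hL'⟩
    case ifNat =>
      simp only [machineStep, MemState.overlay_nat _ _ hP.1, MemState.overlay_nat _ _ hP.2.1]
      split_ifs <;> simp [hP] <;> exact hL'
    case ifReal =>
      simp only [machineStep, MemState.overlay_read _ _ hP.1, MemState.overlay_read _ _ hP.2.1]
      split_ifs <;> simp [hP] <;> exact hL'
    next =>
      simp only [machineStep, MemState.overlay_nat _ _ hP.1, MemState.overlay_nat _ _ hP.2.1]
      split_ifs <;> simp [hP, Prog.Below] <;> exact hL'

theorem iterate_machineStep_overlay {M : ℕ} (e : MemState) (m : ℕ) {L : List Prog}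
    (hL : ∀ P ∈ L, P.Below M) (s : MemState) :
    machineStep^[m] (L, s.overlay M e) =
      ((machineStep^[m] (L, s)).1, (machineStep^[m] (L, s)).2.overlay M e) := by
  induction m generalizing L s with
  | zero => rfl
  | succ m ih =>
    obtain ⟨h1, h2⟩ := machineStep_overlay e hL s
    rw [Function.iterate_succ_apply, Function.iterate_succ_apply, h1, ih h2]

theorem Reaches.overlay {M : ℕ} (e : MemState) {P : Prog} (hP : P.Below M) {s s' : MemState}
    {T : ℕ} (h : Reaches P s s' T) : Reaches P (s.overlay M e) (s'.overlay M e) T := by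
  obtain ⟨m, hm, h⟩ := h
  have h' : machineStep^[m] ([P], s.overlay M e) = ([], s'.overlay M e) := by
    rw [iterate_machineStep_overlay e m (by simpa using hP), h []]
  obtain ⟨l, hl, H⟩ := exists_iterate_append m [P] _ _ h'
  exact ⟨l, hl.trans hm, H⟩

/-! ### Preprocessing of the observations

Scratch variables from `M` on: `M` is zero, `M + 1` is one, `M + 2` and `M + 3` are counters, and
`M + 4` holds `p`.  Scratch arrays from `M` on: `M` holds the noise, `M + 1` the first row of the
design, `M + 2` the first observation, `M + 3` is zero, and `M + 4` is an accumulator. -/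

/-- The cell `(0, 0)` of the array number `a`, if variable `M` is zero. -/
def corner (M a : ℕ) : Ref := ⟨a, M, M⟩

/-- The observation whose number is in variable `M + 2`. -/
def obsRef (M : ℕ) : Ref := ⟨1, M + 2, M⟩

/-- `x := |x|`, if cell `(0, 0)` of array `M + 3` is zero. -/
def absProg (M : ℕ) (x : Ref) : Prog :=
  .ifReal x (corner M (M + 3)) (.sub x (corner M (M + 3)) x) (.natConst (M + 5) 0)

/-- Copy the size and the first row of the data. -/
def saveProg (M : ℕ) : Prog :=
  .seq (.natConst (M + 1) 1) <| .seq (.natAdd (M + 4) 0 M) <|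
  .seq (.add (corner M (M + 2)) (corner M 1) (corner M (M + 3))) <|
  .while (M + 3) (M + 4) <|
    .seq (.add ⟨M + 1, M, M + 3⟩ ⟨0, M, M + 3⟩ (corner M (M + 3)))
      (.natAdd (M + 3) (M + 3) (M + 1))

/-- Apply `G` to every observation. -/
def obsLoop (M : ℕ) (G : Prog) : Prog :=
  .while (M + 2) 1 (.seq G (.natAdd (M + 2) (M + 2) (M + 1)))

/-- `G` replaces the current observation `y` by `f y τ w`, where `w` is a fresh Gaussian. -/
def ModifiesObs (M : ℕ) (G : Prog) (f : ℝ → ℝ → ℝ → ℝ) : Prop :=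
  ∀ s : MemState, s.nat M = 0 → s.arr (M + 3) 0 0 = 0 → ∃ s' : MemState, Reaches G s s' 20 ∧
    (∀ u ≠ M + 5, s'.nat u = s.nat u) ∧ (∀ a, a ≠ 1 → a ≠ M → s'.arr a = s.arr a) ∧
    (∀ r c, s'.arr 1 r c = if r = s.nat (M + 2) ∧ c = 0 then
      f (s.arr 1 r c) (s.arr 2 0 0) (s.tape 0) else s.arr 1 r c) ∧
    s'.tape = fun m => s.tape (m + 1)

/-- The scratch memory holds the constants, the size `p` and a copy of the first row of the data
in `s₀`. -/
structure Saved (M : ℕ) (s₀ s : MemState) : Prop where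
  zero : s.nat M = 0
  one : s.nat (M + 1) = 1
  size : s.nat (M + 4) = s₀.nat 0
  row : ∀ j < s₀.nat 0, s.arr (M + 1) 0 j = s₀.arr 0 0 j
  obs : s.arr (M + 2) 0 0 = s₀.arr 1 0 0
  zeroCell : s.arr (M + 3) 0 0 = 0
  acc : s.arr (M + 4) 0 0 = 0

section Atoms

variable (s : MemState)

theorem reaches_natConst (u c : ℕ) : Reaches (.natConst u c) s (s.setNat u c) 1 :=
  .of_step fun _ => rfl

theorem reaches_natAdd (u v w : ℕ) :
    Reaches (.natAdd u v w) s (s.setNat u (s.nat v + s.nat w)) 1 :=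
  .of_step fun _ => rfl

theorem reaches_add (x y z : Ref) :
    Reaches (.add x y z) s (s.write x (s.read y + s.read z)) 1 :=
  .of_step fun _ => rfl

theorem reaches_sub (x y z : Ref) :
    Reaches (.sub x y z) s (s.write x (s.read y - s.read z)) 1 :=
  .of_step fun _ => rfl

theorem reaches_mul (x y z : Ref) :
    Reaches (.mul x y z) s (s.write x (s.read y * s.read z)) 1 :=
  .of_step fun _ => rfl

theorem reaches_div (x y z : Ref) :
    Reaches (.div x y z) s (s.write x (s.read y / s.read z)) 1 :=
  .of_step fun _ => rfl

theorem reaches_sample (x : Ref) :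
    Reaches (.sample x) s { s.write x (s.tape 0) with tape := fun m => s.tape (m + 1) } 1 :=
  .of_step fun _ => rfl

theorem MemState.setNat_nat (u c v : ℕ) :
    (s.setNat u c).nat v = if v = u then c else s.nat v := by
  simp [MemState.setNat, Function.update_apply]

theorem MemState.setNat_arr (u c : ℕ) : (s.setNat u c).arr = s.arr := rfl

theorem MemState.setNat_tape (u c : ℕ) : (s.setNat u c).tape = s.tape := rfl

theorem MemState.write_nat (x : Ref) (v : ℝ) : (s.write x v).nat = s.nat := rfl

theorem MemState.write_tape (x : Ref) (v : ℝ) : (s.write x v).tape = s.tape := rfl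

theorem MemState.write_arr (x : Ref) (v : ℝ) (a i j : ℕ) : (s.write x v).arr a i j =
    if a = x.arr ∧ i = s.nat x.row ∧ j = s.nat x.col then v else s.arr a i j := rfl

theorem MemState.write_arr_of_ne (x : Ref) (v : ℝ) {a : ℕ} (h : a ≠ x.arr) :
    (s.write x v).arr a = s.arr a := by
  funext i j
  rw [MemState.write_arr, if_neg (fun h' => h h'.1)]

end Atoms

/-- The copies are needed because the observations are about to be modified and `A` may later
overwrite its whole input. `4 ≤ M` keeps the input and output variables and arrays `0, …, 3` out of
the scratch area. -/
theorem reaches_saveProg {M : ℕ} (hM : 4 ≤ M) {s₀ : MemState} (hn : ∀ u, M ≤ u → s₀.nat u = 0)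
    (ha : ∀ a, M ≤ a → s₀.arr a = 0) :
    ∃ s, Reaches (saveProg M) s₀ s (10 + 4 * s₀.nat 0) ∧ Saved M s₀ s ∧ s.nat (M + 2) = 0 ∧
      (∀ u < M, s.nat u = s₀.nat u) ∧ (∀ a < M, s.arr a = s₀.arr a) ∧ s.tape = s₀.tape := by
  have h0 : (0 : ℕ) < M := by omega
  have h1 : (1 : ℕ) < M := by omega
  set s₁ := s₀.setNat (M + 1) 1 with hs₁
  set s₂ := s₁.setNat (M + 4) (s₁.nat 0 + s₁.nat M) with hs₂
  set s₃ := s₂.write (corner M (M + 2))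
    (s₂.read (corner M 1) + s₂.read (corner M (M + 3))) with hs₃
  obtain ⟨s, hr, hs⟩ := Reaches.loop (u := M + 3) (v := M + 4) (b := 3)
    (P := .seq (.add ⟨M + 1, M, M + 3⟩ ⟨0, M, M + 3⟩ (corner M (M + 3)))
      (.natAdd (M + 3) (M + 3) (M + 1)))
    (N := s₀.nat 0) (s := s₃)
    (fun i s => s.nat (M + 3) = i ∧ s.nat M = 0 ∧ s.nat (M + 1) = 1 ∧ s.nat (M + 4) = s₀.nat 0 ∧
      (∀ j < i, s.arr (M + 1) 0 j = s₀.arr 0 0 j) ∧ s.arr (M + 2) 0 0 = s₀.arr 1 0 0 ∧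
      s.arr (M + 3) 0 0 = 0 ∧ s.arr (M + 4) 0 0 = 0 ∧ s.nat (M + 2) = 0 ∧
      (∀ u < M, s.nat u = s₀.nat u) ∧ (∀ a < M, s.arr a = s₀.arr a) ∧ s.tape = s₀.tape)
    (fun i s h => ⟨h.1, h.2.2.2.1⟩)
    (by
      rintro i hi s ⟨e1, e2, e3, e4, e5, e6, e7, e8, e9, e10, e11, e12⟩
      refine ⟨_, (reaches_add _ _ _ _).seq (reaches_natAdd _ _ _ _), ?_⟩
      simp only [MemState.setNat_nat, MemState.setNat_arr, MemState.setNat_tape,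
        MemState.write_nat, MemState.write_tape, MemState.write_arr, MemState.read, corner]
      refine ⟨by simp [e1, e3], by simp [e2], by simp [e3], by simp [e4], fun j hj => ?_,
        by simp [e6], by simp [e7], by simp [e8], by simp [e9], fun u hu => ?_, fun a ha => ?_,
        e12⟩
      · simp only [e2, e1, e7, e11 0 h0, true_and, add_zero]
        split_ifs with h
        · rw [h]
        · exact e5 j (by omega)
      · rw [if_neg (by omega), e10 u hu]
      · rw [MemState.write_arr_of_ne _ _ _ (by simp only; omega), e11 a ha])
    (by
      have z0 : M ≠ 0 := by omega
      have z1 : M ≠ 1 := by omega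
      simp only [hs₃, hs₂, hs₁, MemState.setNat_nat, MemState.setNat_arr, MemState.setNat_tape,
        MemState.write_nat, MemState.write_tape, MemState.write_arr, MemState.read, corner]
      refine ⟨by simp [hn], by simp [hn], by simp, by simp [hn, z0], by simp, by simp [ha, hn],
        by simp [ha], by simp [ha], by simp [hn], fun u hu => ?_, fun a h => ?_, trivial⟩
      · rw [if_neg (by omega), if_neg (by omega)]
      · rw [MemState.write_arr_of_ne _ _ _ (by simp only; omega), MemState.setNat_arr,
          MemState.setNat_arr])
  obtain ⟨-, e2, e3, e4, e5, e6, e7, e8, e9, e10, e11, e12⟩ := hs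
  refine ⟨s, ?_, ⟨e2, e3, e4, e5, e6, e7, e8⟩, e9, e10, e11, e12⟩
  exact ((reaches_natConst _ _ _).seq ((reaches_natAdd _ _ _ _).seq
    ((reaches_add _ _ _ _).seq hr))).mono (by omega)

/-- Each pass consumes exactly one random number, so observation `r` receives entry `r` of the tape
and the unused tape is shifted by the number of observations. -/
theorem reaches_obsLoop {M : ℕ} (hM : 4 ≤ M) {G : Prog} {f : ℝ → ℝ → ℝ → ℝ}
    (hG : ModifiesObs M G f) {s₀ s₁ : MemState} (hs : Saved M s₀ s₁) (h2 : s₁.nat (M + 2) = 0) :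
    ∃ s, Reaches (obsLoop M G) s₁ s (1 + 23 * s₁.nat 1) ∧ Saved M s₀ s ∧
      (∀ u < M, s.nat u = s₁.nat u) ∧ (∀ a < M, a ≠ 1 → s.arr a = s₁.arr a) ∧
      (∀ r c, s.arr 1 r c = if r < s₁.nat 1 ∧ c = 0 then
        f (s₁.arr 1 r c) (s₁.arr 2 0 0) (s₁.tape r) else s₁.arr 1 r c) ∧
      s.tape = fun m => s₁.tape (m + s₁.nat 1) := by
  obtain ⟨s, hr, hI⟩ := Reaches.loop (u := M + 2) (v := 1) (b := 22)
    (P := .seq G (.natAdd (M + 2) (M + 2) (M + 1))) (N := s₁.nat 1) (s := s₁)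
    (fun i s => s.nat (M + 2) = i ∧ Saved M s₀ s ∧
      (∀ u < M, s.nat u = s₁.nat u) ∧ (∀ a < M, a ≠ 1 → s.arr a = s₁.arr a) ∧
      (∀ r c, s.arr 1 r c = if r < i ∧ c = 0 then
        f (s₁.arr 1 r c) (s₁.arr 2 0 0) (s₁.tape r) else s₁.arr 1 r c) ∧
      s.tape = fun m => s₁.tape (m + i))
    (fun i s h => ⟨h.1, h.2.2.1 1 (by omega)⟩)
    (by
      rintro i hi s ⟨e1, e2, e3, e4, e5, e6⟩
      obtain ⟨s', hr, g1, g2, g3, g4⟩ := hG s e2.zero e2.zeroCell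
      refine ⟨_, hr.seq (reaches_natAdd _ _ _ _), ?_, ?_, ?_, ?_, ?_, ?_⟩
      · simp [MemState.setNat_nat, g1, e1, e2.one]
      · constructor
        · simp [MemState.setNat_nat, g1, e2.zero]
        · simp [MemState.setNat_nat, g1, e2.one]
        · simp [MemState.setNat_nat, g1, e2.size]
        · intro j hj
          rw [MemState.setNat_arr, g2 _ (by omega) (by omega), e2.row j hj]
        · rw [MemState.setNat_arr, g2 _ (by omega) (by omega), e2.obs]
        · rw [MemState.setNat_arr, g2 _ (by omega) (by omega), e2.zeroCell]
        · rw [MemState.setNat_arr, g2 _ (by omega) (by omega), e2.acc]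
      · intro u hu
        rw [MemState.setNat_nat, if_neg (by omega), g1 _ (by omega), e3 u hu]
      · intro a ha h1
        rw [MemState.setNat_arr, g2 _ h1 (by omega), e4 a ha h1]
      · intro r c
        rw [MemState.setNat_arr, g3, e1, e5, e4 2 (by omega) (by omega), e6]
        by_cases hc : c = 0
        · rcases lt_trichotomy r i with h | h | h
          · simp [hc, h.ne, h, Nat.lt_succ_of_lt h]
          · simp [hc, h]
          · simp [hc, h.ne', not_lt.2 h.le, not_lt.2 (Nat.succ_le_of_lt h)]
        · simp [hc]
      · rw [MemState.setNat_tape, g4, e6]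
        funext m
        simp only
        congr 1
        omega)
    ⟨h2, hs, fun _ _ => rfl, fun _ _ _ => rfl, by simp, by simp⟩
  exact ⟨s, hr.mono (by omega), hI.2⟩

/-- The modified observations, with the first random numbers of the machine as noise. -/
def modifiedObs {n : ℕ} (f : ℝ → ℝ → ℝ → ℝ) (τ : ℝ) (y : Fin n → ℝ) (t : ℕ → ℝ) : Fin n → ℝ :=
  fun r => f (y r) τ (t r)

/-- Preprocess the data, then run `A`. -/
def reduceProg (M : ℕ) (G A : Prog) : Prog := .seq (saveProg M) (.seq (obsLoop M G) A)

theorem reaches_reduceProg {M : ℕ} (hM : 4 ≤ M) {G A : Prog} {f : ℝ → ℝ → ℝ → ℝ}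
    (hG : ModifiesObs M G f) (hA : A.Below M) {p n k T : ℕ} {τ : ℝ} {d : Data n p} {t : ℕ → ℝ}
    {s' : MemState}
    (h : Reaches A (inputState p n k τ (d.1, modifiedObs f τ d.2 t) fun m => t (m + n)) s' T) :
    ∃ e, Saved M (inputState p n k τ d t) e ∧
      Reaches (reduceProg M G A) (inputState p n k τ d t) (s'.overlay M e)
        (13 + 4 * p + 23 * n + T) := by
  obtain ⟨s₁, hr₁, hs₁, a1, a2, a3, a4⟩ := reaches_saveProg hM (s₀ := inputState p n k τ d t)
    (by
      intro u hu
      simp only [inputState]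
      rw [if_neg (by omega), if_neg (by omega), if_neg (by omega)])
    (by
      intro a ha
      funext i j
      simp only [inputState]
      rw [if_neg (by omega), if_neg (by omega), if_neg (by omega)]
      rfl)
  obtain ⟨s₂, hr₂, hs₂, b1, b2, b3, b4⟩ := reaches_obsLoop hM hG hs₁ a1
  have hn : s₁.nat 1 = n := by rw [a2 1 (by omega)]; rfl
  -- Below `M` the memory is a genuine input state for the modified data, so the given run of `A`
  -- transfers by the frame property.
  have key : (inputState p n k τ (d.1, modifiedObs f τ d.2 t) fun m => t (m + n)).overlay M s₂
      = s₂ := by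
    refine MemState.overlay_eq_self (fun u hu => ?_) (fun a ha => ?_) ?_
    · rw [b1 u hu, a2 u hu]
      rfl
    · by_cases h1 : a = 1
      · subst h1
        funext r c
        rw [b3, hn, a3 1 (by omega), a3 2 (by omega), a4]
        simp only [inputState, modifiedObs, one_ne_zero, if_false, if_true]
        by_cases h : r < n ∧ c = 0 <;> simp [h]
      · rw [b2 a ha h1, a3 a ha]
        simp only [inputState, if_neg h1]
    · rw [b4, hn, a4]
      rfl
  refine ⟨s₂, hs₂, (hr₁.seq (hr₂.seq (key ▸ h.overlay s₂ hA))).mono ?_⟩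
  rw [hn]
  simp only [inputState, if_true]
  omega

/-! ### Verification of a candidate signal -/

/-- Compare the square of the first observation with that of its prediction from the signs of the
entries of the output vector. -/
def verifyProg (M : ℕ) : Prog :=
  .seq (.natConst (M + 3) 0) <|
  .seq (.while (M + 3) (M + 4)
    (.seq
      (.ifReal (corner M (M + 3)) ⟨3, M + 3, M⟩
        (.add (corner M (M + 4)) (corner M (M + 4)) ⟨M + 1, M, M + 3⟩)
        (.ifReal ⟨3, M + 3, M⟩ (corner M (M + 3))
          (.sub (corner M (M + 4)) (corner M (M + 4)) ⟨M + 1, M, M + 3⟩)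
          (.add (corner M (M + 4)) (corner M (M + 4)) (corner M (M + 3)))))
      (.natAdd (M + 3) (M + 3) (M + 1)))) <|
  .seq (.mul (corner M (M + 4)) (corner M (M + 4)) (corner M (M + 4))) <|
  .seq (.mul (corner M (M + 2)) (corner M (M + 2)) (corner M (M + 2))) <|
  .ifReal (corner M (M + 4)) (corner M (M + 2)) (.natConst 3 0)
    (.ifReal (corner M (M + 2)) (corner M (M + 4)) (.natConst 3 0) (.natConst 3 1))

/-- The prediction of the first observation from the signs of a candidate signal. -/
def signSum (s₀ s : MemState) (p : ℕ) : ℝ :=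
  ∑ j ∈ Finset.range p, Real.sign (s.arr 3 j 0) * s₀.arr 0 0 j

/-- Squares make the check blind to the global sign. Equality of reals is decided by the failure of
both strict comparisons. -/
theorem reaches_verifyProg {M : ℕ} (hM : 4 ≤ M) {s₀ s₁ : MemState} (hs : Saved M s₀ s₁) :
    ∃ s, Reaches (verifyProg M) s₁ s (12 + 6 * s₀.nat 0) ∧
      (signSum s₀ s₁ (s₀.nat 0) ^ 2 = s₀.arr 1 0 0 ^ 2 → outputBit s = 1) ∧
      (signSum s₀ s₁ (s₀.nat 0) ^ 2 ≠ s₀.arr 1 0 0 ^ 2 → outputBit s = 0) := by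
  have h3 : (3 : ℕ) ≠ M + 4 := by omega
  obtain ⟨s, hr, e1, e2, e3, e4, e5, e6, e7, e8, e9⟩ := Reaches.loop (u := M + 3) (v := M + 4)
    (b := 5)
    (P := .seq
      (.ifReal (corner M (M + 3)) ⟨3, M + 3, M⟩
        (.add (corner M (M + 4)) (corner M (M + 4)) ⟨M + 1, M, M + 3⟩)
        (.ifReal ⟨3, M + 3, M⟩ (corner M (M + 3))
          (.sub (corner M (M + 4)) (corner M (M + 4)) ⟨M + 1, M, M + 3⟩)
          (.add (corner M (M + 4)) (corner M (M + 4)) (corner M (M + 3)))))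
      (.natAdd (M + 3) (M + 3) (M + 1)))
    (N := s₀.nat 0) (s := s₁.setNat (M + 3) 0)
    (fun i s => s.nat (M + 3) = i ∧ s.nat M = 0 ∧ s.nat (M + 1) = 1 ∧ s.nat (M + 4) = s₀.nat 0 ∧
      (∀ j < s₀.nat 0, s.arr (M + 1) 0 j = s₀.arr 0 0 j) ∧ s.arr (M + 2) 0 0 = s₀.arr 1 0 0 ∧
      s.arr (M + 3) 0 0 = 0 ∧ s.arr (M + 4) 0 0 = signSum s₀ s₁ i ∧ s.arr 3 = s₁.arr 3)
    (fun i s h => ⟨h.1, h.2.2.2.1⟩)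
    (by
      rintro i hi s ⟨e1, e2, e3, e4, e5, e6, e7, e8, e9⟩
      have hbody : Reaches (.ifReal (corner M (M + 3)) ⟨3, M + 3, M⟩
        (.add (corner M (M + 4)) (corner M (M + 4)) ⟨M + 1, M, M + 3⟩)
        (.ifReal ⟨3, M + 3, M⟩ (corner M (M + 3))
          (.sub (corner M (M + 4)) (corner M (M + 4)) ⟨M + 1, M, M + 3⟩)
          (.add (corner M (M + 4)) (corner M (M + 4)) (corner M (M + 3)))))
          s (s.write (corner M (M + 4)) (signSum s₀ s₁ (i + 1))) 3 := by
        have hx : s.read ⟨M + 1, M, M + 3⟩ = s₀.arr 0 0 i := by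
          simp only [MemState.read, e1, e2, e5 i hi]
        have ha : s.read (corner M (M + 4)) = signSum s₀ s₁ i := by
          simp only [MemState.read, corner, e2, e8]
        have hz : s.read (corner M (M + 3)) = 0 := by
          simp only [MemState.read, corner, e2, e7]
        have hb : s.read ⟨3, M + 3, M⟩ = s₁.arr 3 i 0 := by
          simp only [MemState.read, e1, e2, e9]
        refine Reaches.ifReal (fun h => ?_) (fun h => Reaches.ifReal (fun h' => ?_) fun h' => ?_)
        · convert (reaches_add s _ _ _).mono one_le_two using 2
          rw [ha, hx, signSum, Finset.sum_range_succ, ← signSum, Real.sign_of_pos, one_mul]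
          rwa [hz, hb] at h
        · convert reaches_sub s _ _ _ using 2
          rw [ha, hx, signSum, Finset.sum_range_succ, ← signSum, Real.sign_of_neg]
          · ring
          · rwa [hz, hb] at h'
        · convert reaches_add s _ _ _ using 2
          rw [hz, hb] at h h'
          rw [ha, hz, signSum, Finset.sum_range_succ, ← signSum,
            le_antisymm (not_lt.1 h) (not_lt.1 h'), Real.sign_zero, zero_mul]
      refine ⟨_, hbody.seq (reaches_natAdd _ _ _ _), ?_⟩
      simp only [MemState.setNat_nat, MemState.setNat_arr, MemState.write_nat,
        MemState.write_arr, corner]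
      refine ⟨by simp [e1, e3], by simp [e2], by simp [e3], by simp [e4],
        fun j hj => by simp [e5 j hj], by simp [e6], by simp [e7], by simp [e2], ?_⟩
      rw [MemState.write_arr_of_ne _ _ _ h3, e9])
    (by
      simp only [MemState.setNat_nat, MemState.setNat_arr]
      exact ⟨by simp, by simp [hs.zero], by simp [hs.one], by simp [hs.size], hs.row, hs.obs,
        hs.zeroCell, by simp [hs.acc, signSum], trivial⟩)
  set s₂ := s.write (corner M (M + 4)) (s.read (corner M (M + 4)) * s.read (corner M (M + 4)))
    with hs₂
  set s₃ := s₂.write (corner M (M + 2)) (s₂.read (corner M (M + 2)) * s₂.read (corner M (M + 2)))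
    with hs₃
  set b := signSum s₀ s₁ (s₀.nat 0) with hb
  have hb1 : s₃.read (corner M (M + 4)) = b ^ 2 := by
    simp [hs₃, hs₂, MemState.read, MemState.write_arr, MemState.write_nat, corner, e2, e8, sq]
  have hb2 : s₃.read (corner M (M + 2)) = s₀.arr 1 0 0 ^ 2 := by
    simp [hs₃, hs₂, MemState.read, MemState.write_arr, MemState.write_nat, corner, e2, e6, sq]
  have hfin : Reaches (.ifReal (corner M (M + 4)) (corner M (M + 2)) (.natConst 3 0)
      (.ifReal (corner M (M + 2)) (corner M (M + 4)) (.natConst 3 0) (.natConst 3 1))) s₃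
      (s₃.setNat 3 (if b ^ 2 = s₀.arr 1 0 0 ^ 2 then 1 else 0)) 3 := by
    refine Reaches.ifReal (fun h => ?_) (fun h => Reaches.ifReal (fun h' => ?_) fun h' => ?_)
    · rw [hb1, hb2] at h
      rw [if_neg h.ne]
      exact (reaches_natConst _ _ _).mono one_le_two
    · rw [hb1, hb2] at h'
      rw [if_neg h'.ne']
      exact reaches_natConst _ _ _
    · rw [hb1, hb2] at h h'
      rw [if_pos (le_antisymm (not_lt.1 h') (not_lt.1 h))]
      exact reaches_natConst _ _ _
  refine ⟨_, ((reaches_natConst _ _ _).seq (hr.seq ((reaches_mul _ _ _ _).seq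
    ((reaches_mul _ _ _ _).seq hfin)))).mono (by omega), fun h => ?_, fun h => ?_⟩
  · simp [outputBit, MemState.setNat_nat, h]
  · simp [outputBit, MemState.setNat_nat, h]

/-- Preprocess the data, run the estimator `A`, and verify its output. -/
def testProg (M : ℕ) (G A : Prog) : Prog := .seq (reduceProg M G A) (verifyProg M)

/-- Everything saved lives at indices from `M` on, hence survives the run of `A`. -/
theorem Saved.overlay {M : ℕ} {s₀ e : MemState} (h : Saved M s₀ e) (s : MemState) :
    Saved M s₀ (s.overlay M e) := by
  constructor <;> simp [MemState.overlay, h.zero, h.one, h.size, h.obs, h.zeroCell, h.acc]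
  exact h.row

theorem reaches_testProg {M : ℕ} (hM : 4 ≤ M) {G A : Prog} {f : ℝ → ℝ → ℝ → ℝ}
    (hG : ModifiesObs M G f) (hA : A.Below M) {p n k T : ℕ} {τ : ℝ} {d : Data n p} {t : ℕ → ℝ}
    {s' : MemState}
    (h : Reaches A (inputState p n k τ (d.1, modifiedObs f τ d.2 t) fun m => t (m + n)) s' T) :
    ∃ s, Reaches (testProg M G A) (inputState p n k τ d t) s (26 + 10 * p + 23 * n + T) ∧
      (signSum (inputState p n k τ d t) s' p ^ 2 = (inputState p n k τ d t).arr 1 0 0 ^ 2 →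
        outputBit s = 1) ∧
      (signSum (inputState p n k τ d t) s' p ^ 2 ≠ (inputState p n k τ d t).arr 1 0 0 ^ 2 →
        outputBit s = 0) := by
  obtain ⟨e, he, hr⟩ := reaches_reduceProg hM hG hA h
  obtain ⟨s, hs, h1, h0⟩ := reaches_verifyProg hM (he.overlay s')
  have hp : (inputState p n k τ d t).nat 0 = p := rfl
  have h3 : (s'.overlay M e).arr 3 = s'.arr 3 := if_pos (by omega)
  simp only [signSum, hp, h3] at h1 h0
  exact ⟨s, (hr.seq hs).mono (by rw [hp]; omega), h1, h0⟩

/-! ### Modifications of one observation -/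

/-- Variable `M + 5` is exempted because the branch with nothing to do assigns to it as a dummy
instruction. -/
theorem reaches_absProg {M : ℕ} {s : MemState} (h0 : s.nat M = 0) (hz : s.arr (M + 3) 0 0 = 0)
    (x : Ref) : ∃ s', Reaches (absProg M x) s s' 2 ∧ (∀ u ≠ M + 5, s'.nat u = s.nat u) ∧
      s'.arr = (s.write x |s.read x|).arr ∧ s'.tape = s.tape := by
  have hc : s.read (corner M (M + 3)) = 0 := by simp only [MemState.read, corner, h0, hz]
  by_cases h : s.read x < 0
  · refine ⟨_, Reaches.ifReal (fun _ => reaches_sub _ _ _ _) (fun h' => ?_), fun _ _ => rfl, ?_,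
      rfl⟩
    · exact absurd (hc ▸ h) h'
    · rw [hc, zero_sub, abs_of_neg h]
  · refine ⟨_, Reaches.ifReal (fun h' => ?_) (fun _ => reaches_natConst _ _ _), fun u hu => ?_, ?_,
      rfl⟩
    · exact absurd (hc ▸ h') h
    · rw [MemState.setNat_nat, if_neg hu]
    · funext a i j
      rw [MemState.setNat_arr, MemState.write_arr, abs_of_nonneg (not_lt.1 h)]
      split_ifs with h'
      · rw [h'.1, h'.2.1, h'.2.2]
        rfl
      · rfl

/-- `y := |y| + τ w` -/
def absAddNoise (M : ℕ) : Prog :=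
  .seq (.sample (corner M M)) <| .seq (.mul (corner M M) (corner M M) (corner M 2)) <|
  .seq (absProg M (obsRef M)) (.add (obsRef M) (obsRef M) (corner M M))

/-- `y := y ^ 2 + τ w` -/
def sqAddNoise (M : ℕ) : Prog :=
  .seq (.sample (corner M M)) <| .seq (.mul (corner M M) (corner M M) (corner M 2)) <|
  .seq (.mul (obsRef M) (obsRef M) (obsRef M)) (.add (obsRef M) (obsRef M) (corner M M))

/-- `y := |y| / τ + w` -/
def absDivAddNoise (M : ℕ) : Prog :=
  .seq (.sample (corner M M)) <| .seq (absProg M (obsRef M)) <|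
  .seq (.div (obsRef M) (obsRef M) (corner M 2)) (.add (obsRef M) (obsRef M) (corner M M))

theorem modifiesObs_absAddNoise {M : ℕ} (hM : 4 ≤ M) :
    ModifiesObs M (absAddNoise M) fun y τ w => |y| + τ * w := by
  intro s h0 hz
  set s₁ : MemState :=
    { s.write (corner M M) (s.tape 0) with tape := fun m => s.tape (m + 1) } with hs₁
  set s₂ := s₁.write (corner M M) (s₁.read (corner M M) * s₁.read (corner M 2)) with hs₂
  have m1 : 1 ≠ M := by omega
  have m2 : 2 ≠ M := by omega
  have hz₂ : s₂.arr (M + 3) 0 0 = 0 := by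
    simp [hs₂, hs₁, MemState.write_arr, corner, hz]
  obtain ⟨s₃, hr, e1, e2, e3⟩ := reaches_absProg (s := s₂) h0 hz₂ (obsRef M)
  refine ⟨_, ((reaches_sample _ _).seq ((reaches_mul _ _ _ _).seq (hr.seq
    (reaches_add _ _ _ _)))).mono (by omega), fun u hu => e1 u hu, fun a h1 hM' => ?_,
    fun r c => ?_, e3⟩
  · rw [MemState.write_arr_of_ne _ _ _ h1, e2, MemState.write_arr_of_ne _ _ _ h1,
      MemState.write_arr_of_ne _ _ _ hM', MemState.write_arr_of_ne _ _ _ hM']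
  · simp only [MemState.write_arr, MemState.read, e2, e1 M (by omega), e1 (M + 2) (by omega),
      obsRef, corner, hs₂, hs₁, MemState.write_nat, h0]
    simp [m1, m1.symm, m2]
    split_ifs with h
    · rw [h.1, h.2]; ring
    · rfl

theorem modifiesObs_sqAddNoise {M : ℕ} (hM : 4 ≤ M) :
    ModifiesObs M (sqAddNoise M) fun y τ w => y ^ 2 + τ * w := by
  intro s h0 hz
  have m1 : 1 ≠ M := by omega
  have m2 : 2 ≠ M := by omega
  refine ⟨_, ((reaches_sample _ _).seq ((reaches_mul _ _ _ _).seq ((reaches_mul _ _ _ _).seq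
    (reaches_add _ _ _ _)))).mono (by omega), fun u hu => rfl, fun a h1 hM' => ?_,
    fun r c => ?_, rfl⟩
  · rw [MemState.write_arr_of_ne _ _ _ h1, MemState.write_arr_of_ne _ _ _ h1,
      MemState.write_arr_of_ne _ _ _ hM', MemState.write_arr_of_ne _ _ _ hM']
  · simp only [MemState.write_arr, MemState.read,
      obsRef, corner, MemState.write_nat, h0]
    simp [m1, m1.symm, m2]
    split_ifs with h
    · rw [h.1, h.2]; ring
    · rfl

theorem modifiesObs_absDivAddNoise {M : ℕ} (hM : 4 ≤ M) :
    ModifiesObs M (absDivAddNoise M) fun y τ w => |y| / τ + w := by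
  intro s h0 hz
  set s₁ : MemState :=
    { s.write (corner M M) (s.tape 0) with tape := fun m => s.tape (m + 1) } with hs₁
  have m1 : 1 ≠ M := by omega
  have m2 : 2 ≠ M := by omega
  have hz₁ : s₁.arr (M + 3) 0 0 = 0 := by
    simp [hs₁, MemState.write_arr, corner, hz]
  obtain ⟨s₃, hr, e1, e2, e3⟩ := reaches_absProg (s := s₁) h0 hz₁ (obsRef M)
  refine ⟨_, ((reaches_sample _ _).seq (hr.seq ((reaches_div _ _ _ _).seq
    (reaches_add _ _ _ _)))).mono (by omega), fun u hu => e1 u hu, fun a h1 hM' => ?_,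
    fun r c => ?_, e3⟩
  · rw [MemState.write_arr_of_ne _ _ _ h1, MemState.write_arr_of_ne _ _ _ h1, e2,
      MemState.write_arr_of_ne _ _ _ h1, MemState.write_arr_of_ne _ _ _ hM']
  · simp only [MemState.write_arr, MemState.read, e2, e1 M (by omega), e1 (M + 2) (by omega),
      obsRef, corner, hs₁, MemState.write_nat, h0]
    simp [m1, m1.symm, m2]
    split_ifs with h
    · rw [h.1, h.2]
    · rfl

/-! ### The random source -/

instance : IsProbabilityMeasure tapeLaw := by unfold tapeLaw; infer_instance

instance (n : ℕ) : IsProbabilityMeasure (gaussVec n) := by unfold gaussVec; infer_instance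

instance (n p : ℕ) : IsProbabilityMeasure (gaussMat n p) := by unfold gaussMat; infer_instance

instance (n : ℕ) : IsProbabilityMeasure (fairCoins n) := by unfold fairCoins; infer_instance

/-- For `p < k` there is no such vector and the prior is the zero measure. -/
instance (p k : ℕ) : IsZeroOrProbabilityMeasure (signalPrior p k) := by
  unfold signalPrior; infer_instance

/-- The first `n` random numbers, and the remaining ones. -/
def splitTape (n : ℕ) (t : ℕ → ℝ) : (Fin n → ℝ) × (ℕ → ℝ) := (fun r => t r, fun m => t (m + n))

theorem measurable_splitTape (n : ℕ) : Measurable (splitTape n) := by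
  unfold splitTape; fun_prop

/-- `Measure.infinitePi` is characterised by its values on boxes, so it is easier to push the
product law forward along the right inverse `join`, and then apply `splitTape` to both sides. -/
theorem measurePreserving_splitTape (n : ℕ) :
    MeasurePreserving (splitTape n) tapeLaw ((gaussVec n).prod tapeLaw) := by
  set join : (Fin n → ℝ) × (ℕ → ℝ) → ℕ → ℝ := fun q m =>
    if h : m < n then q.1 ⟨m, h⟩ else q.2 (m - n) with hj
  have hjm : Measurable join := by
    refine measurable_pi_lambda _ fun m => ?_
    by_cases h : m < n
    · simp only [hj, h, dif_pos]; fun_prop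
    · simp only [hj, h, dif_neg, not_false_eq_true]; fun_prop
  have hinv : splitTape n ∘ join = id := by
    funext q
    refine Prod.ext (funext fun r => ?_) (funext fun m => ?_)
    · simp [splitTape, hj]
    · simp [splitTape, hj]
  have key : ((gaussVec n).prod tapeLaw).map join = tapeLaw := by
    refine Measure.eq_infinitePi _ fun s t ht => ?_
    classical
    -- The preimage of a box is a product of boxes: indices below `n` constrain the first factor,
    -- the others constrain the second after a shift by `n`.
    have hpre : join ⁻¹' Set.pi s t =
        (Set.univ.pi fun r : Fin n => if (r : ℕ) ∈ s then t r else Set.univ) ×ˢ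
          Set.pi ((s.filter (n ≤ ·)).image (· - n) : Finset ℕ) fun m => t (m + n) := by
      ext q
      simp only [Set.mem_preimage, Set.mem_pi, Set.mem_prod, Finset.coe_image, hj]
      constructor
      · intro h
        refine ⟨fun r _ => ?_, ?_⟩
        · split_ifs with hr
          · simpa using h r hr
          · trivial
        · rintro _ ⟨m, hm, rfl⟩
          have hm' := Finset.mem_filter.1 hm
          have := h m hm'.1
          rw [dif_neg (not_lt.2 hm'.2)] at this
          simpa [Nat.sub_add_cancel hm'.2] using this
      · rintro ⟨h1, h2⟩ m hm
        split_ifs with h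
        · have := h1 ⟨m, h⟩ trivial
          simpa [Finset.mem_coe.1 hm] using this
        · have := h2 (m - n) ⟨m, Finset.mem_coe.2 (Finset.mem_filter.2 ⟨hm, not_lt.1 h⟩), rfl⟩
          simpa [Nat.sub_add_cancel (not_lt.1 h)] using this
    rw [Measure.map_apply hjm (MeasurableSet.pi s.countable_toSet fun i _ => ht i), hpre,
      Measure.prod_prod, gaussVec, Measure.pi_pi, tapeLaw, Measure.infinitePi_pi _
        (fun m _ => ht (m + n)), ← Finset.prod_filter_mul_prod_filter_not s (n ≤ ·),
      Finset.prod_image, mul_comm]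
    · congr 1
      · refine Finset.prod_congr rfl fun m hm => ?_
        rw [Nat.sub_add_cancel (Finset.mem_filter.1 hm).2]
      · rw [Fin.prod_univ_eq_prod_range
          (fun r => gaussianReal 0 1 (if r ∈ s then t r else Set.univ)) n]
        have : ∀ r ∈ Finset.range n, gaussianReal 0 1 (if r ∈ s then t r else Set.univ) =
            if r ∈ s then gaussianReal 0 1 (t r) else 1 := by
          intro r _
          split_ifs <;> simp
        rw [Finset.prod_congr rfl this, ← Finset.prod_filter]
        refine Finset.prod_congr ?_ fun _ _ => rfl
        ext r
        simp only [Finset.mem_filter, Finset.mem_range, not_le]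
        exact and_comm
    · intro a ha b hb hab
      have ha' := (Finset.mem_filter.1 (Finset.mem_coe.1 ha)).2
      have hb' := (Finset.mem_filter.1 (Finset.mem_coe.1 hb)).2
      simp only at hab
      omega
  refine ⟨measurable_splitTape n, ?_⟩
  conv_lhs => rw [← key, Measure.map_map (measurable_splitTape n) hjm, hinv, Measure.map_id]

/-- The first random numbers of the tape can be used as part of the data. -/
theorem measurePreserving_useTape {α : Type*} [MeasurableSpace α] (μ : Measure α) [SFinite μ]
    (n : ℕ) :
    MeasurePreserving (fun q : α × (ℕ → ℝ) => ((q.1, (splitTape n q.2).1), (splitTape n q.2).2))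
      (μ.prod tapeLaw) ((μ.prod (gaussVec n)).prod tapeLaw) :=
  ((measurePreserving_prodAssoc μ (gaussVec n) tapeLaw).symm MeasurableEquiv.prodAssoc).comp
    ((MeasurePreserving.id μ).prod (measurePreserving_splitTape n))

theorem measurable_rowProd {n p : ℕ} (r : Fin n) :
    Measurable fun q : Design n p × (Fin p → ℝ) => rowProd q.1 q.2 r := by
  unfold rowProd; fun_prop

theorem finite_signVectors (p : ℕ) :
    {β : Fin p → ℝ | ∀ j, β j = -1 ∨ β j = 0 ∨ β j = 1}.Finite := by
  refine (Set.Finite.pi' fun _ : Fin p => Set.toFinite ({-1, 0, 1} : Set ℝ)).subset ?_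
  intro β hβ j
  simpa using hβ j

theorem finite_sparseSigns (p k : ℕ) : (sparseSigns p k).Finite :=
  (finite_signVectors p).subset fun _ h => h.1

theorem ae_mem_sparseSigns (p k : ℕ) : ∀ᵐ β ∂signalPrior p k, β ∈ sparseSigns p k :=
  (uniformOn_eq_zero_iff (finite_sparseSigns p k)).2 (Set.inter_compl_self _)

/-! ### The laws of the modified data -/

/-- The data with modified observations, and the random numbers that remain. -/
def modifyData {n p : ℕ} (f : ℝ → ℝ → ℝ → ℝ) (τ : ℝ) (q : Data n p × (ℕ → ℝ)) :
    Data n p × (ℕ → ℝ) :=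
  ((q.1.1, modifiedObs f τ q.1.2 q.2), fun m => q.2 (m + n))

theorem measurable_modifyData {n p : ℕ} (τ : ℝ) :
    Measurable (modifyData (n := n) (p := p) (fun y τ w => |y| / τ + w) τ) := by
  unfold modifyData modifiedObs; fun_prop

theorem measurable_sbmslrdNull_obs (p n : ℕ) (c : ℝ) :
    Measurable fun q : Design n p × (Fin n → ℝ) => (q.1, fun r => c * q.2 r) := by
  fun_prop

theorem measurable_sbmslrdPlanted_obs (p n : ℕ) (σ : ℝ) :
    Measurable fun q : (Fin p → ℝ) × (Design n p × ((Fin n → Bool) × (Fin n → ℝ))) =>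
      (q.2.1, mslrObs σ q.2.1 q.1 (-q.1) q.2.2.1 q.2.2.2) := by
  refine (measurable_fst.comp measurable_snd).prodMk (measurable_pi_lambda _ fun r => ?_)
  unfold mslrObs
  refine Measurable.add (Measurable.ite ?_ ?_ ?_) (by fun_prop)
  · have h : Measurable fun q : (Fin p → ℝ) × (Design n p × ((Fin n → Bool) × (Fin n → ℝ))) =>
      q.2.2.1 r := by fun_prop
    exact h (MeasurableSet.singleton true)
  · exact (measurable_rowProd r).comp
      ((measurable_fst.comp measurable_snd).prodMk measurable_fst)
  · exact (measurable_rowProd r).comp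
      ((measurable_fst.comp measurable_snd).prodMk measurable_fst.neg)

theorem prod_tapeLaw_map {α β : Type*} [MeasurableSpace α] [MeasurableSpace β] (μ : Measure α)
    [SFinite μ] {F : α → β} (hF : Measurable F) :
    (μ.map F).prod tapeLaw = (μ.prod tapeLaw).map (Prod.map F id) := by
  conv_lhs => rw [← Measure.map_id (μ := tapeLaw)]
  exact Measure.map_prod_map _ _ hF measurable_id

theorem rowProd_neg {n p : ℕ} (X : Design n p) (β : Fin p → ℝ) (r : Fin n) :
    rowProd X (-β) r = -rowProd X β r := by
  simp [rowProd, Finset.sum_neg_distrib]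

/-- The crux of both reductions: a label only selects a sign, which the absolute value forgets. -/
theorem abs_mslrObs {n p : ℕ} (X : Design n p) (β : Fin p → ℝ) (z : Fin n → Bool)
    (w : Fin n → ℝ) (r : Fin n) : |mslrObs 0 X β (-β) z w r| = |rowProd X β r| := by
  rw [mslrObs, zero_mul, add_zero, rowProd_neg]
  split_ifs
  · rfl
  · exact abs_neg _

/-- Replace labels and noise by the first random numbers of the tape. -/
theorem measurePreserving_replaceNoise (p n k : ℕ) :
    MeasurePreserving
      (fun q : ((Fin p → ℝ) × (Design n p × ((Fin n → Bool) × (Fin n → ℝ)))) × (ℕ → ℝ) =>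
        ((q.1.1, (q.1.2.1, (splitTape n q.2).1)), (splitTape n q.2).2))
      (((signalPrior p k).prod ((gaussMat n p).prod ((fairCoins n).prod (gaussVec n)))).prod
        tapeLaw)
      (((signalPrior p k).prod ((gaussMat n p).prod (gaussVec n))).prod tapeLaw) := by
  -- Labels and the mixture's own noise can be discarded: the former disappear under absolute
  -- values, the latter is multiplied by `0`.
  have h1 : MeasurePreserving
      (Prod.map id Prod.fst : (Fin p → ℝ) × (Design n p × ((Fin n → Bool) × (Fin n → ℝ))) → _)
      ((signalPrior p k).prod ((gaussMat n p).prod ((fairCoins n).prod (gaussVec n))))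
      ((signalPrior p k).prod (gaussMat n p)) :=
    (MeasurePreserving.id _).prod measurePreserving_fst
  have h2 := (measurePreserving_useTape ((signalPrior p k).prod (gaussMat n p)) n).comp
    (h1.prod (MeasurePreserving.id tapeLaw))
  exact ((measurePreserving_prodAssoc (signalPrior p k) (gaussMat n p) (gaussVec n)).prod
    (MeasurePreserving.id tapeLaw)).comp h2

/-- The null observation is `√k w₁`, so `|y| / σ = √(k / σ ^ 2) |w₁|`; the tape supplies the second
Gaussian vector. -/
theorem map_modifyData_null (p n k : ℕ) {σ : ℝ} (hσ : 0 < σ) :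
    ((sbmslrdNull p n k 0).prod tapeLaw).map (modifyData (fun y τ w => |y| / τ + w) σ) =
      (sprdNull p n k σ).prod tapeLaw := by
  have hF : Measurable fun q : Design n p × ((Fin n → ℝ) × (Fin n → ℝ)) =>
      (q.1, fun r => √((k : ℝ) / σ ^ 2) * |q.2.1 r| + q.2.2 r) := by fun_prop
  have h := ((measurePreserving_prodAssoc (gaussMat n p) (gaussVec n) (gaussVec n)).prod
    (MeasurePreserving.id tapeLaw)).comp
    (measurePreserving_useTape ((gaussMat n p).prod (gaussVec n)) n)
  rw [sbmslrdNull, sprdNull, prod_tapeLaw_map _ (measurable_sbmslrdNull_obs p n _),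
    prod_tapeLaw_map _ hF, Measure.map_map (measurable_modifyData σ)
      ((measurable_sbmslrdNull_obs p n _).prodMap measurable_id), ← h.map_eq,
    Measure.map_map (hF.prodMap measurable_id) h.measurable]
  congr 1
  funext q
  refine Prod.ext (Prod.ext rfl (funext fun r => ?_)) rfl
  change |√((k : ℝ) + 0 ^ 2) * q.1.2 r| / σ + q.2 r = √((k : ℝ) / σ ^ 2) * |q.1.2 r| + q.2 r
  rw [abs_mul, abs_of_nonneg (Real.sqrt_nonneg _), Real.sqrt_div' _ (sq_nonneg σ),
    Real.sqrt_sq hσ.le, zero_pow two_ne_zero, add_zero]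
  ring

theorem map_modifyData_planted (p n k : ℕ) (σ : ℝ) :
    ((sbmslrdPlanted p n k 0).prod tapeLaw).map (modifyData (fun y τ w => |y| / τ + w) σ) =
      (sprdPlanted p n k σ).prod tapeLaw := by
  have hF : Measurable fun q : (Fin p → ℝ) × (Design n p × (Fin n → ℝ)) =>
      (q.2.1, fun r => 1 / σ * |rowProd q.2.1 q.1 r| + q.2.2 r) := by
    unfold rowProd; fun_prop
  have h := measurePreserving_replaceNoise p n k
  rw [sbmslrdPlanted, sprdPlanted, prod_tapeLaw_map _ (measurable_sbmslrdPlanted_obs p n 0),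
    prod_tapeLaw_map _ hF, Measure.map_map (measurable_modifyData σ)
      ((measurable_sbmslrdPlanted_obs p n 0).prodMap measurable_id), ← h.map_eq,
    Measure.map_map (hF.prodMap measurable_id) h.measurable]
  congr 1
  funext q
  refine Prod.ext (Prod.ext rfl (funext fun r => ?_)) rfl
  change |mslrObs 0 q.1.2.1 q.1.1 (-q.1.1) q.1.2.2.1 q.1.2.2.2 r| / σ + q.2 r =
    1 / σ * |rowProd q.1.2.1 q.1.1 r| + q.2 r
  rw [abs_mslrObs]
  ring

/-- A failure under the planted law that entails a failure of an estimator for every signal which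
is consistent with the data is as unlikely as the latter. -/
theorem sbmslrdPlanted_failure_le (p n k : ℕ) (E : Set (Data n p × (ℕ → ℝ)))
    (F : Set ((Fin p → ℝ) × (Design n p × ((Fin n → ℝ) × (ℕ → ℝ)))))
    (h : ∀ X y t, ((X, y), t) ∈ E → ∀ β ∈ sparseSigns p k, (∀ r, |y r| = |rowProd X β r|) →
      (β, (X, splitTape n t)) ∈ F) :
    ((sbmslrdPlanted p n k 0).prod tapeLaw) E ≤
      ((signalPrior p k).prod ((gaussMat n p).prod ((gaussVec n).prod tapeLaw))) F := by
  set ν := (signalPrior p k).prod ((gaussMat n p).prod ((gaussVec n).prod tapeLaw)) with hν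
  -- `F` need not be measurable, so it is replaced by a measurable hull of the same measure.
  have hG : MeasurableSet (toMeasurable ν F) := measurableSet_toMeasurable ν F
  -- The signal is not part of the data, so `H` demands failure for every signal consistent with
  -- them. The intersection is finite, hence measurable.
  set H : Set (Data n p × (ℕ → ℝ)) := ⋂ β ∈ sparseSigns p k,
    ({q | ∀ r, |q.1.2 r| = |rowProd q.1.1 β r|}ᶜ ∪
      {q | (β, (q.1.1, splitTape n q.2)) ∈ toMeasurable ν F}) with hH
  have hHm : MeasurableSet H := by
    refine MeasurableSet.biInter (finite_sparseSigns p k).countable fun β _ => ?_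
    refine MeasurableSet.union (MeasurableSet.compl ?_) ?_
    · rw [Set.ofPred_forall]
      refine MeasurableSet.iInter fun r => measurableSet_eq_fun (by fun_prop) ?_
      unfold rowProd
      fun_prop
    · have := measurable_splitTape n
      exact (show Measurable fun q : Data n p × (ℕ → ℝ) => (β, (q.1.1, splitTape n q.2)) by
        fun_prop) hG
  have hEH : E ⊆ H := by
    rintro ⟨⟨X, y⟩, t⟩ hq
    refine Set.mem_iInter₂.2 fun β hβ => ?_
    by_cases hy : ∀ r, |y r| = |rowProd X β r|
    · exact Or.inr (subset_toMeasurable ν F (h X y t hq β hβ hy))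
    · exact Or.inl hy
  have hM : MeasurePreserving
      (fun q : ((Fin p → ℝ) × (Design n p × ((Fin n → Bool) × (Fin n → ℝ)))) × (ℕ → ℝ) =>
        (q.1.1, (q.1.2.1, splitTape n q.2)))
      (((signalPrior p k).prod ((gaussMat n p).prod ((fairCoins n).prod (gaussVec n)))).prod
        tapeLaw) ν :=
    ((MeasurePreserving.id (signalPrior p k)).prod
      (measurePreserving_prodAssoc (gaussMat n p) (gaussVec n) tapeLaw)).comp
      ((measurePreserving_prodAssoc (signalPrior p k) ((gaussMat n p).prod (gaussVec n))
        tapeLaw).comp (measurePreserving_replaceNoise p n k))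
  have hae : ∀ᵐ q ∂(((signalPrior p k).prod
      ((gaussMat n p).prod ((fairCoins n).prod (gaussVec n)))).prod tapeLaw),
      q.1.1 ∈ sparseSigns p k :=
    (Measure.quasiMeasurePreserving_fst.comp Measure.quasiMeasurePreserving_fst).ae
      (ae_mem_sparseSigns p k)
  have hF := measurable_sbmslrdPlanted_obs p n 0
  calc ((sbmslrdPlanted p n k 0).prod tapeLaw) E
      ≤ ((sbmslrdPlanted p n k 0).prod tapeLaw) H := measure_mono hEH
    _ = (((signalPrior p k).prod ((gaussMat n p).prod ((fairCoins n).prod (gaussVec n)))).prod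
        tapeLaw) (Prod.map _ id ⁻¹' H) := by
        rw [sbmslrdPlanted, prod_tapeLaw_map _ hF,
          Measure.map_apply (hF.prodMap measurable_id) hHm]
    _ ≤ (((signalPrior p k).prod ((gaussMat n p).prod ((fairCoins n).prod (gaussVec n)))).prod
        tapeLaw) ((fun q => (q.1.1, (q.1.2.1, splitTape n q.2))) ⁻¹' toMeasurable ν F) := by
        refine measure_mono_ae ?_
        -- The true signal is almost surely sparse and always consistent with its own data, so it is
        -- among those to which `H` applies.
        filter_upwards [hae] with q hβ hq
        rcases Set.mem_iInter₂.1 hq _ hβ with h' | h'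
        · exact absurd (fun r => abs_mslrObs _ _ _ _ r) h'
        · exact h'
    _ = ν (toMeasurable ν F) := hM.measure_preimage hG.nullMeasurableSet
    _ = ν F := measure_toMeasurable F

/-- Under the null law, no sign vector predicts an observation. -/
theorem sbmslrdNull_prediction_eq_zero (p n k : ℕ) (hk : 0 < k) (r : Fin n) :
    ((sbmslrdNull p n k 0).prod tapeLaw) {q | ∃ β : Fin p → ℝ,
      (∀ j, β j = -1 ∨ β j = 0 ∨ β j = 1) ∧ rowProd q.1.1 β r ^ 2 = q.1.2 r ^ 2} = 0 := by
  set S : Set (Data n p) := ⋃ β ∈ {β : Fin p → ℝ | ∀ j, β j = -1 ∨ β j = 0 ∨ β j = 1},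
    {d | rowProd d.1 β r ^ 2 = d.2 r ^ 2} with hS
  have hSm : ∀ β : Fin p → ℝ, MeasurableSet {d : Data n p | rowProd d.1 β r ^ 2 = d.2 r ^ 2} := by
    intro β
    refine measurableSet_eq_fun ?_ (by fun_prop)
    unfold rowProd
    fun_prop
  have hk' : 0 < √((k : ℝ) + 0 ^ 2) := Real.sqrt_pos.2 (by positivity)
  have h0 : sbmslrdNull p n k 0 S = 0 := by
    refine (measure_biUnion_null_iff (finite_signVectors p).countable).2 fun β _ => ?_
    have hm := measurable_sbmslrdNull_obs p n √((k : ℝ) + 0 ^ 2)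
    rw [sbmslrdNull, Measure.map_apply hm (hSm β), Measure.measure_prod_null (hm (hSm β))]
    refine Eventually.of_forall fun X => ?_
    have hN : NullSingletonClass (gaussianReal 0 1) :=
      nullSingletonClass_gaussianReal one_ne_zero
    -- With `X` and `β` fixed, a match forces the Gaussian `w r` onto one of two points.
    have hfin : gaussVec n ((fun w => w r) ⁻¹'
        {rowProd X β r / √((k : ℝ) + 0 ^ 2), -(rowProd X β r / √((k : ℝ) + 0 ^ 2))}) = 0 := by
      exact ((measurePreserving_eval (fun _ : Fin n => gaussianReal 0 1) r).measure_preimage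
        (Set.toFinite _).measurableSet.nullMeasurableSet).trans ((Set.toFinite _).measure_zero _)
    refine measure_mono_null (fun w hw => ?_) hfin
    have hw' : rowProd X β r ^ 2 = (√((k : ℝ) + 0 ^ 2) * w r) ^ 2 := hw
    rcases sq_eq_sq_iff_eq_or_eq_neg.1 hw' with h | h
    · left
      rw [h, mul_div_cancel_left₀ _ hk'.ne']
    · right
      rw [Set.mem_singleton_iff, h, neg_div, neg_neg, mul_div_cancel_left₀ _ hk'.ne']
  refine measure_mono_null (t := S ×ˢ Set.univ) ?_ (by rw [Measure.prod_prod, h0, zero_mul])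
  rintro q ⟨β, hβ, h⟩
  exact ⟨Set.mem_iUnion₂.2 ⟨β, hβ, h⟩, trivial⟩

/-! ### Parameter regimes -/

theorem ParamSeq.Base.noiseless {θ : ParamSeq} (h : θ.Base) : θ.noiseless.Base := h

theorem ParamSeq.C3.noiseless {θ : ParamSeq} (h : θ.C3) : θ.noiseless.C3 := h

/-- At `σ = 0` the bound `(k + σ ^ 2) ^ 2 / log p` is `k ^ 2 / log p`. -/
theorem ParamSeq.C3.noiseless_C1 {θ : ParamSeq} (h : θ.C3) : θ.noiseless.C1 := by
  refine ⟨h.1.noiseless, ?_⟩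
  simpa [ParamSeq.noiseless] using h.2

theorem ParamSeq.Base.noiseless_C2 {θ : ParamSeq} (h : θ.Base) : θ.noiseless.C2 :=
  ⟨h.noiseless, 1, one_pos, Eventually.of_forall fun _ h => absurd rfl h⟩

theorem ParamSeq.Base.eventually_one_le_log {θ : ParamSeq} (h : θ.Base) :
    ∀ᶠ i in atTop, 1 ≤ Real.log (θ.p i) :=
  (Real.tendsto_log_atTop.comp (tendsto_natCast_atTop_atTop.comp h.1)).eventually_ge_atTop 1

theorem ParamSeq.Base.eventually_n_pos {θ : ParamSeq} (h : θ.Base) : ∀ᶠ i in atTop, 0 < θ.n i := by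
  filter_upwards [h.eventually_one_le_log, h.2.2.bound one_pos] with i h1 h2
  rw [Real.norm_eq_abs, Real.norm_eq_abs, one_mul, Nat.abs_cast] at h2
  have h3 : (1 : ℝ) ≤ θ.n i := (h1.trans (le_max_right _ _)).trans ((le_abs_self _).trans h2)
  exact_mod_cast h3

theorem ParamSeq.C3.eventually_n_le {θ : ParamSeq} (h : θ.C3) :
    ∀ᶠ i in atTop, (θ.n i : ℝ) ≤ (θ.k i : ℝ) ^ 2 := by
  filter_upwards [h.1.eventually_one_le_log, h.2.bound one_pos] with i h1 h2
  rw [Real.norm_eq_abs, Real.norm_eq_abs, one_mul, Nat.abs_cast,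
    abs_of_nonneg (by positivity)] at h2
  exact h2.trans (div_le_self (by positivity) h1)

/-- Follows from `0 < n ≤ k ^ 2`; it makes the null observation nondegenerate. -/
theorem ParamSeq.C3.eventually_k_pos {θ : ParamSeq} (h : θ.C3) : ∀ᶠ i in atTop, 0 < θ.k i := by
  filter_upwards [h.1.eventually_n_pos, h.eventually_n_le] with i h1 h2
  refine Nat.pos_of_ne_zero fun hk => ?_
  rw [hk, Nat.cast_zero, zero_pow two_ne_zero] at h2
  exact absurd (Nat.cast_pos.2 h1) (not_lt.2 h2)

/-- Eventually `n ≤ k ^ 2 ≤ p`. The constant `N` absorbs the finitely many other indices, since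
`PolyTime` requires its bound at every `i`. -/
theorem ParamSeq.C3.exists_n_le {θ : ParamSeq} (h : θ.C3) : ∃ N, ∀ i, θ.n i ≤ θ.p i + N := by
  have hev : ∀ᶠ i in atTop, θ.n i ≤ θ.p i := by
    filter_upwards [h.eventually_n_le, h.1.2.1.bound one_pos] with i h1 h2
    rw [Real.norm_eq_abs, Real.norm_eq_abs, one_mul, Nat.abs_cast,
      abs_of_nonneg (Real.sqrt_nonneg _)] at h2
    have h3 : (θ.k i : ℝ) ^ 2 ≤ θ.p i :=
      (pow_le_pow_left₀ (Nat.cast_nonneg _) h2 2).trans_eq (Real.sq_sqrt (Nat.cast_nonneg _))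
    exact_mod_cast h1.trans h3
  obtain ⟨i₀, hi₀⟩ := eventually_atTop.1 hev
  refine ⟨∑ i ∈ Finset.range i₀, θ.n i, fun i => ?_⟩
  by_cases hi : i₀ ≤ i
  · exact (hi₀ i hi).trans (Nat.le_add_right _ _)
  · exact (Finset.single_le_sum (f := θ.n) (fun _ _ => Nat.zero_le _)
      (Finset.mem_range.2 (not_le.1 hi))).trans (Nat.le_add_left _ _)

/-- A polynomial-time reduction preserves polynomial time. -/
theorem PolyTime.of_reduction {A B : Prog} {θ : ParamSeq} (hθ : θ.C3) {τ : ℕ → ℝ}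
    (hA : PolyTime A τ θ) (C : ℕ)
    (h : ∀ i (d : Data (θ.n i) (θ.p i)) t T,
      (∀ d' t', HaltsWithin A (inputState (θ.p i) (θ.n i) (θ.k i) (τ i) d' t') T) →
      HaltsWithin B (inputState (θ.p i) (θ.n i) (θ.k i) (τ i) d t)
        (C * (1 + θ.p i + θ.n i) + T)) :
    PolyTime B τ θ.noiseless := by
  obtain ⟨c, hc⟩ := hA
  obtain ⟨N, hN⟩ := hθ.exists_n_le
  -- The first summand pays for the overhead, as `1 + p + n ≤ 1 + 2 p + N`; `2 * c` pays for `A`;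
  -- the last `1` makes the exponent positive.
  refine ⟨C * (3 + N) + 2 * c + 1, fun i d t => ?_⟩
  obtain ⟨s, hs⟩ := (h i d t _ (hc i)).exists_reaches
  refine hs.haltsWithin ?_
  change _ ≤ (C * (3 + N) + 2 * c + 1) * (θ.p i ^ (C * (3 + N) + 2 * c + 1) + 1)
  set e := C * (3 + N) + 2 * c + 1 with he
  have pow_le : ∀ a ≤ e, θ.p i ^ a ≤ θ.p i ^ e + 1 := by
    intro a ha
    rcases Nat.eq_zero_or_pos (θ.p i) with h0 | h0
    · rw [h0]
      exact (pow_le_one₀ le_rfl zero_le_one).trans (Nat.le_add_left _ _)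
    · exact (Nat.pow_le_pow_right h0 ha).trans (Nat.le_succ _)
  have h1 : θ.p i ≤ θ.p i ^ e := Nat.le_self_pow (by omega) _
  have h2 : c * (θ.p i ^ c + 1) ≤ (2 * c + 1) * (θ.p i ^ e + 1) := by
    have := Nat.mul_le_mul_left c (pow_le c (by omega))
    nlinarith
  have h3 : C * (1 + θ.p i + θ.n i) ≤ C * (3 + N) * (θ.p i ^ e + 1) := by
    rw [mul_assoc]
    refine Nat.mul_le_mul_left _ ?_
    have := hN i
    nlinarith
  calc _ ≤ C * (3 + N) * (θ.p i ^ e + 1) + (2 * c + 1) * (θ.p i ^ e + 1) := Nat.add_le_add h3 h2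
    _ = e * (θ.p i ^ e + 1) := by rw [he]; ring

/-! ### Correctness of the reductions -/

theorem signSum_inputState {p n k : ℕ} {τ : ℝ} {d : Data n p} {t : ℕ → ℝ} (s : MemState)
    (hn : 0 < n) : signSum (inputState p n k τ d t) s p =
      rowProd d.1 (fun j => Real.sign (outputVector p s j)) ⟨0, hn⟩ := by
  rw [signSum, Finset.sum_range, rowProd]
  refine Finset.sum_congr rfl fun j _ => ?_
  rw [mul_comm]
  simp [inputState, outputVector, hn]

theorem inputState_obs_zero {p n k : ℕ} {τ : ℝ} {d : Data n p} {t : ℕ → ℝ} (hn : 0 < n) :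
    (inputState p n k τ d t).arr 1 0 0 = d.2 ⟨0, hn⟩ := by
  simp [inputState, hn]

theorem sign_eq_self {x : ℝ} (h : x = -1 ∨ x = 0 ∨ x = 1) : Real.sign x = x := by
  rcases h with rfl | rfl | rfl <;> norm_num [Real.sign]

/-- Only termination of `A` matters: whatever it returns, and however this depends on `y`, the
rounded output is a sign vector. -/
theorem testProg_null_failure {M : ℕ} (hM : 4 ≤ M) {G A : Prog} {f : ℝ → ℝ → ℝ → ℝ}
    (hG : ModifiesObs M G f) (hA : A.Below M) {p n k T : ℕ} {τ : ℝ} (hn : 0 < n) (hk : 0 < k)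
    (hT : ∀ (d : Data n p) t, HaltsWithin A (inputState p n k τ d t) T) :
    ((sbmslrdNull p n k 0).prod tapeLaw) {q | ¬ ∃ s',
      HaltsIn (testProg M G A) (inputState p n k τ q.1 q.2) s' ∧ outputBit s' = 0} = 0 := by
  refine measure_mono_null ?_ (sbmslrdNull_prediction_eq_zero p n k hk ⟨0, hn⟩)
  rintro ⟨d, t⟩ hq
  obtain ⟨s', hs'⟩ := (hT (d.1, modifiedObs f τ d.2 t) fun m => t (m + n)).exists_reaches
  obtain ⟨s, hs, -, h0⟩ := reaches_testProg hM hG hA hs'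
  by_contra hne
  refine hq ⟨s, hs.haltsIn, h0 fun heq => hne
    ⟨fun j => Real.sign (outputVector p s' j), fun j => Real.sign_apply_eq _, ?_⟩⟩
  rwa [signSum_inputState _ hn, inputState_obs_zero hn] at heq

theorem testProg_planted_failure {g : ℝ → ℝ} (hg : ∀ x, g |x| = g x) {M : ℕ} (hM : 4 ≤ M)
    {G A : Prog} (hG : ModifiesObs M G fun y τ w => g y + τ * w) (hA : A.Below M)
    {p n k T : ℕ} {σ : ℝ} (hn : 0 < n)
    (hT : ∀ (d : Data n p) t, HaltsWithin A (inputState p n k σ d t) T) :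
    ((sbmslrdPlanted p n k 0).prod tapeLaw) {q | ¬ ∃ s',
      HaltsIn (testProg M G A) (inputState p n k σ q.1 q.2) s' ∧ outputBit s' = 1} ≤
    ((signalPrior p k).prod ((gaussMat n p).prod ((gaussVec n).prod tapeLaw)))
      {q | ¬ ∃ s', HaltsIn A (inputState p n k σ (q.2.1, sprObs g σ q.2.1 q.1 q.2.2.1) q.2.2.2) s' ∧
        (outputVector p s' = q.1 ∨ outputVector p s' = -q.1)} := by
  refine sbmslrdPlanted_failure_le _ _ _ _ _ fun X y t hq β hβ hy => ?_
  rintro ⟨s', hin, hout⟩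
  -- As `g` is even, any signal consistent with `|y|` turns the modified data into its own phase
  -- retrieval observations.
  have hobs : sprObs g σ X β (splitTape n t).1 =
      modifiedObs (fun y τ w => g y + τ * w) σ y t := by
    funext r
    simp only [sprObs, modifiedObs, splitTape]
    rw [← hg (y r), hy r, hg]
  obtain ⟨s'', hs''⟩ := (hT _ _).exists_reaches
  obtain rfl := hin.eq_of_reaches hs''
  simp only [hobs] at hs''
  obtain ⟨s, hs, h1, -⟩ := reaches_testProg hM hG hA (d := (X, y)) (t := t) hs''
  refine hq ⟨s, hs.haltsIn, h1 ?_⟩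
  rw [signSum_inputState _ hn, inputState_obs_zero hn, ← sq_abs (y _), hy, sq_abs]
  rcases hout with h | h
  · rw [h, funext fun j => sign_eq_self (hβ.1 j)]
  · have : (fun j => Real.sign ((-β) j)) = -β :=
      funext fun j => by rw [Pi.neg_apply, Real.sign_neg, sign_eq_self (hβ.1 j)]
    rw [h, this, rowProd_neg, neg_sq]

theorem recovery_yields_detection {g : ℝ → ℝ} (hg : ∀ x, g |x| = g x) {M : ℕ} (hM : 4 ≤ M)
    {G A : Prog} (hG : ModifiesObs M G fun y τ w => g y + τ * w) (hA : A.Below M) {θ : ParamSeq}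
    (hθ : θ.C3) (hT : PolyTime A θ.σ θ) (hS : SolvesSPR g A θ) :
    PolyTime (testProg M G A) θ.σ θ.noiseless ∧
      SolvesSBMSLRD (testProg M G A) θ.σ θ.noiseless := by
  constructor
  · refine hT.of_reduction hθ 30 fun i d t T h => ?_
    obtain ⟨s', hs'⟩ := (h _ _).exists_reaches
    obtain ⟨s, hs, -⟩ := reaches_testProg hM hG hA hs'
    exact hs.haltsWithin (by omega)
  · obtain ⟨c, hc⟩ := hT
    refine tendsto_of_tendsto_of_tendsto_of_le_of_le' tendsto_const_nhds hS
      (Eventually.of_forall fun _ => zero_le) ?_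
    filter_upwards [hθ.1.eventually_n_pos, hθ.eventually_k_pos] with i hn hk
    exact (add_le_add (testProg_null_failure hM hG hA hn hk (hc i)).le
      (testProg_planted_failure hg hM hG hA hn (hc i))).trans_eq (zero_add _)

theorem detection_yields_detection {M : ℕ} (hM : 4 ≤ M) {A : Prog} (hA : A.Below M) {θ : ParamSeq}
    (hθ : θ.C3) (hσ : ∀ i, 0 < θ.σ i) (hT : PolyTime A θ.σ θ) (hS : SolvesSPRD A θ) :
    PolyTime (reduceProg M (absDivAddNoise M) A) θ.σ θ.noiseless ∧
      SolvesSBMSLRD (reduceProg M (absDivAddNoise M) A) θ.σ θ.noiseless := by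
  have hG := modifiesObs_absDivAddNoise hM
  constructor
  · refine hT.of_reduction hθ 30 fun i d t T h => ?_
    obtain ⟨s', hs'⟩ := (h _ _).exists_reaches
    obtain ⟨e, -, hs⟩ := reaches_reduceProg hM hG hA hs'
    exact hs.haltsWithin (by omega)
  · obtain ⟨c, hc⟩ := hT
    -- Failure on the original data entails failure of `A` on the modified data. This inclusion
    -- suffices, since `Measure.le_map_apply` holds for arbitrary sets.
    have key : ∀ i (b : ℕ),
        {q : Data (θ.n i) (θ.p i) × (ℕ → ℝ) | ¬ ∃ s',
          HaltsIn (reduceProg M (absDivAddNoise M) A)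
            (inputState (θ.p i) (θ.n i) (θ.k i) (θ.σ i) q.1 q.2) s' ∧ outputBit s' = b} ⊆
        modifyData (fun y τ w => |y| / τ + w) (θ.σ i) ⁻¹' {q | ¬ ∃ s',
          HaltsIn A (inputState (θ.p i) (θ.n i) (θ.k i) (θ.σ i) q.1 q.2) s' ∧
            outputBit s' = b} := by
      rintro i b ⟨d, t⟩ hq ⟨s', hin, hout⟩
      obtain ⟨s'', hs''⟩ := (hc i _ _).exists_reaches
      obtain rfl := hin.eq_of_reaches hs''
      obtain ⟨e, -, hs⟩ := reaches_reduceProg hM hG hA hs''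
      refine hq ⟨_, hs.haltsIn, ?_⟩
      rw [← hout]
      exact MemState.overlay_nat _ _ (by omega)
    refine tendsto_of_tendsto_of_tendsto_of_le_of_le tendsto_const_nhds hS
      (fun _ => zero_le) fun i => add_le_add ?_ ?_
    · rw [← map_modifyData_null _ _ _ (hσ i)]
      exact (measure_mono (key i 0)).trans
        (Measure.le_map_apply (measurable_modifyData _).aemeasurable _)
    · rw [← map_modifyData_planted]
      exact (measure_mono (key i 1)).trans
        (Measure.le_map_apply (measurable_modifyData _).aemeasurable _)

/-- `M`, and with it `B`, depends only on `A` and on which `g` is used, so one test serves all `θ`.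
-/
theorem exists_detection_of_recovery {g : ℝ → ℝ} (hg : (g = fun x => |x|) ∨ (g = fun x => x ^ 2))
    (A : Prog) : ∃ B : Prog, ∀ θ : ParamSeq, θ.C3 → PolyTime A θ.σ θ → SolvesSPR g A θ →
      PolyTime B θ.σ θ.noiseless ∧ SolvesSBMSLRD B θ.σ θ.noiseless := by
  obtain ⟨M, hA, hM⟩ := (A.eventually_below.and (eventually_ge_atTop 4)).exists
  rcases hg with rfl | rfl
  · exact ⟨_, fun θ h => recovery_yields_detection (fun x => abs_abs x) hM
      (modifiesObs_absAddNoise hM) hA h⟩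
  · exact ⟨_, fun θ h => recovery_yields_detection (fun x => sq_abs x) hM
      (modifiesObs_sqAddNoise hM) hA h⟩

end

theorem mainTheorem9 :
    -- recovery in sparse phase retrieval yields detection in the noiseless mixture
    (∀ g : ℝ → ℝ, (g = fun x => |x|) ∨ (g = fun x => x ^ 2) →
      ∀ A : Prog, ∃ B : Prog, ∀ θ : ParamSeq, θ.C2 → θ.C3 → Tendsto θ.snr atTop (𝓝 ⊤) →
        PolyTime A θ.σ θ → SolvesSPR g A θ →
          θ.noiseless.C1 ∧ θ.noiseless.C2 ∧ θ.noiseless.C3 ∧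
            PolyTime B θ.σ θ.noiseless ∧ SolvesSBMSLRD B θ.σ θ.noiseless) ∧
    -- hence hardness of detection contradicts the existence of a recovery algorithm
    (∀ g : ℝ → ℝ, (g = fun x => |x|) ∨ (g = fun x => x ^ 2) →
      ∀ θ : ParamSeq, θ.C2 → θ.C3 → Tendsto θ.snr atTop (𝓝 ⊤) →
        (θ.noiseless.C1 → SBMSLRDHard θ.noiseless) →
          ¬ ∃ A : Prog, PolyTime A θ.σ θ ∧ SolvesSPR g A θ) ∧
    -- detection in sparse phase retrieval yields detection in the noiseless mixture
    (∀ A : Prog, ∃ B : Prog, ∀ θ : ParamSeq, θ.C3 → (∀ i, 0 < θ.σ i) →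
      PolyTime A θ.σ θ → SolvesSPRD A θ →
        θ.noiseless.C3 ∧ PolyTime B θ.σ θ.noiseless ∧ SolvesSBMSLRD B θ.σ θ.noiseless) := by
  refine ⟨fun g hg A => ?_, fun g hg θ h2 h3 _ hard => ?_, fun A => ?_⟩
  · obtain ⟨B, hB⟩ := exists_detection_of_recovery hg A
    exact ⟨B, fun θ _ h3 _ hT hS =>
      ⟨h3.noiseless_C1, h3.1.noiseless_C2, h3.noiseless, hB θ h3 hT hS⟩⟩
  · rintro ⟨A, hT, hS⟩
    obtain ⟨B, hB⟩ := exists_detection_of_recovery hg A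
    -- Hardness allows any real parameter, here the noise level that the reduction injects.
    exact hard h3.noiseless_C1 B θ.σ (hB θ h3 hT hS)
  · obtain ⟨M, hA, hM⟩ := (A.eventually_below.and (eventually_ge_atTop 4)).exists
    exact ⟨_, fun θ h3 hσ hT hS =>
      ⟨h3.noiseless, detection_yields_detection hM hA h3 hσ hT hS⟩⟩
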